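/- Let $m\ge 2$ and $k\ge 2$ be integers, $\mathcal S^{k-1}=\{x\in\mathbb R^k:\|x\|=1\}$. For $\kappa>0$ and $\theta\in\mathcal S^{k-1}$, the Fisher--von Mises--Langevin (FvML) distribution with concentration $\kappa$ and location $\theta$ is the probability distribution on $\mathcal S^{k-1}$ whose density with respect to the surface area measure is proportional to $x\mapsto\exp(\kappa\,x'\theta)$. Put $$\tilde f_\kappa(t)=\frac{e^{\kappa t}(1-t^2)^{(k-3)/2}}{\int_{-1}^1 e^{\kappa u}(1-u^2)^{(k-3)/2}\,du}\quad(-1\le t\le 1),\qquad A_k(\kappa)=\int_{-1}^1 t\tilde f_\kappa(t)\,dt,\qquad \mathcal J_k(\kappa)=\int_{-1}^1(1-u^2)\tilde f_\kappa(u)\,du .$$ For each $n$, let $n_1,\dots,n_m$ (depending on $n$) be nonnegative integers with $\sum_{i=1}^m n_i=n$, and assume (Assumption A) that for each $i$ the ratio $r_i^{(n)}:=n_i/n$ converges to a constant $r_i>0$ as $n\to\infty$. For $\vartheta=(\kappa_1,\dots,\kappa_m,\theta_1',\dots,\theta_m')'\in\Theta:=(0,\infty)^m\times(\mathcal S^{k-1})^m\subset\mathbb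 R^m\times(\mathbb R^k)^m$, let $\mathrm P^{(n)}_\vartheta$ be the joint distribution of $m$ mutually independent samples $X_{i1},\dots,X_{in_i}$, $i=1,\dots,m$, where the $X_{ij}$, $j=1,\dots,n_i$, are i.i.d. FvML with concentration $\kappa_i$ and location $\theta_i$. Let $$\nu^{(n)}=\mathrm{diag}\big((r_1^{(n)})^{-1/2},\dots,(r_m^{(n)})^{-1/2},(r_1^{(n)})^{-1/2}I_k,\dots,(r_m^{(n)})^{-1/2}I_k\big).$$ Define the central sequence $\Delta^{(n)}_\vartheta\in\mathbb R^m\times(\mathbb R^k)^m$ as the vector with components $$\Delta^{(\mathrm I,i)(n)}_\vartheta=n_i^{-1/2}\sum_{j=1}^{n_i}\big(X_{ij}'\theta_i-A_k(\kappa_i)\big)\in\mathbb R,\qquad \Delta^{(\mathrm{II},i)(n)}_\vartheta=\kappa_i n_i^{-1/2}\sum_{j=1}^{n_i}\big(1-(X_{ij}'\theta_i)^2\big)^{1/2}S_{\theta_i}(X_{ij})\in\mathbb R^k,$$ $i=1,\dots,m$ (first all the $\Delta^{(\mathrm I,i)(n)}_\vartheta$, then all the $\Delta^{(\mathrm{II},i)(n)}_\vartheta$),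 where $S_\theta(x)=(x-(x'\theta)\theta)/\|x-(x'\theta)\theta\|$, and the block-diagonal Fisher information $$\Gamma_\vartheta=\mathrm{diag}\big(\Gamma^{(\mathrm I,1)}_\vartheta,\dots,\Gamma^{(\mathrm I,m)}_\vartheta,\Gamma^{(\mathrm{II},1)}_\vartheta,\dots,\Gamma^{(\mathrm{II},m)}_\vartheta\big),$$ $$\Gamma^{(\mathrm I,i)}_\vartheta=1-\frac{k-1}{\kappa_i}A_k(\kappa_i)-A_k(\kappa_i)^2,\qquad \Gamma^{(\mathrm{II},i)}_\vartheta=\frac{\kappa_i^2\mathcal J_k(\kappa_i)}{k-1}\,(I_k-\theta_i\theta_i').$$ **Proposition.** The family $\{\mathrm P^{(n)}_\vartheta:\vartheta\in\Theta\}$ is uniformly locally asymptotically normal (ULAN): for any $\vartheta\in\Theta$, any sequence $\vartheta^{(n)}\in\Theta$ with $\vartheta^{(n)}-\vartheta=O(n^{-1/2})$ and any bounded sequence $\tau^{(n)}\in\mathbb R^m\times(\mathbb R^k)^m$ such that $\vartheta^{(n)}+n^{-1/2}\nu^{(n)}\tau^{(n)}\in\Theta$ for all $n$, $$\log\frac{d\mathrm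 P^{(n)}_{\vartheta^{(n)}+n^{-1/2}\nu^{(n)}\tau^{(n)}}}{d\mathrm P^{(n)}_{\vartheta^{(n)}}}=(\tau^{(n)})'\Delta^{(n)}_{\vartheta^{(n)}}-\frac12(\tau^{(n)})'\,\Gamma_\vartheta\,\tau^{(n)}+o_{\mathrm P}(1),$$ and $\Gamma_\vartheta$ is positive semidefinite with $$\Delta^{(n)}_{\vartheta^{(n)}}\ \xrightarrow{\ \mathcal D\ }\ \mathcal N_{m(k+1)}(0,\Gamma_\vartheta),$$ both under $\mathrm P^{(n)}_{\vartheta^{(n)}}$ as $n\to\infty$. -/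

import Mathlib

open MeasureTheory ProbabilityTheory Filter Topology Asymptotics Matrix

namespace FvML

noncomputable section

/-- The unit sphere `S^{k-1}` of `ℝ^k`. -/
abbrev Sphere (k : ℕ) : Type := Metric.sphere (0 : EuclideanSpace ℝ (Fin k)) 1

/-- The usual surface area measure on `S^{k-1}`. -/
def surfaceMeasure (k : ℕ) : Measure (Sphere k) :=
  (volume : Measure (EuclideanSpace ℝ (Fin k))).toSphere

/-- The Fisher-von Mises-Langevin distribution on `S^{k-1}` with concentration `κ` and location
`θ`: its density with respect to the surface area measure is `x ↦ c * exp (κ * ⟪x, θ⟫)`, where the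
normalizing constant is `c = (∫ x, exp (κ * ⟪x, θ⟫))⁻¹`. -/
def fvml (k : ℕ) (κ : ℝ) (θ : EuclideanSpace ℝ (Fin k)) : Measure (Sphere k) :=
  (surfaceMeasure k).tilted
    (fun x => κ * inner ℝ (x : EuclideanSpace ℝ (Fin k)) θ)

instance isProbabilityMeasure_fvml (k : ℕ) [k.AtLeastTwo] (κ : ℝ) (θ : EuclideanSpace ℝ (Fin k)) :
    IsProbabilityMeasure (fvml k κ θ) := by
  have : Nonempty (Fin k) := ⟨⟨0, by have := Nat.AtLeastTwo.prop (n := k); omega⟩⟩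
  have : IsFiniteMeasure (surfaceMeasure k) := by unfold surfaceMeasure; infer_instance
  have : NeZero (surfaceMeasure k) := by
    refine ⟨?_⟩
    unfold surfaceMeasure
    simp
  refine isProbabilityMeasure_tilted ?_
  have hc : Continuous (fun x : Sphere k =>
      Real.exp (κ * inner ℝ (x : EuclideanSpace ℝ (Fin k)) θ)) := by fun_prop
  exact hc.integrable_of_hasCompactSupport (HasCompactSupport.of_compactSpace _)

/-- The unnormalized density `exp (κ t) (1 - t²)^{(k-3)/2}` on `[-1, 1]` of the projection of an
FvML vector on its location. -/
def projWeight (k : ℕ) (κ t : ℝ) : ℝ :=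
  Real.exp (κ * t) * (1 - t ^ 2) ^ (((k : ℝ) - 3) / 2)

/-- The density on `[-1, 1]` of the projection of an FvML vector on its location. -/
def projDensity (k : ℕ) (κ t : ℝ) : ℝ :=
  projWeight k κ t / ∫ u in (-1 : ℝ)..1, projWeight k κ u

/-- The function `A_k`. -/
def meanA (k : ℕ) (κ : ℝ) : ℝ :=
  (∫ t in (-1 : ℝ)..1, t * projWeight k κ t) / ∫ t in (-1 : ℝ)..1, projWeight k κ t

/-- The function `J_k`. -/
def fisherJ (k : ℕ) (κ : ℝ) : ℝ :=
  ∫ u in (-1 : ℝ)..1, (1 - u ^ 2) * projDensity k κ u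

/-- The coordinates of `ℝ^m × (ℝ^k)^m`: `Sum.inl i` is the `i`-th concentration coordinate and
`Sum.inr (a, i)` is the `a`-th coordinate of the `i`-th location. -/
abbrev Idx (m k : ℕ) : Type := Fin m ⊕ (Fin k × Fin m)

/-- The space `ℝ^m × (ℝ^k)^m ≅ ℝ^{m(k+1)}` with its Euclidean norm. -/
abbrev Vec (m k : ℕ) : Type := EuclideanSpace ℝ (Idx m k)

/-- The `i`-th concentration of `v = (κ₁, …, κ_m, θ₁, …, θ_m)`. -/
def conc {m k : ℕ} (v : Vec m k) (i : Fin m) : ℝ := v (Sum.inl i)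

/-- The `i`-th location of `v = (κ₁, …, κ_m, θ₁, …, θ_m)`. -/
def loc {m k : ℕ} (v : Vec m k) (i : Fin m) : EuclideanSpace ℝ (Fin k) :=
  WithLp.toLp 2 (fun a => v (Sum.inr (a, i)))

/-- The parameter set `(0, ∞)^m × (S^{k-1})^m`. -/
def paramSet (m k : ℕ) : Set (Vec m k) :=
  {v | ∀ i, 0 < conc v i ∧ ‖loc v i‖ = 1}

/-- Data sets made of `m` samples of points of `S^{k-1}`, the `i`-th one of size `N i`. -/
abbrev Sample (m k : ℕ) (N : Fin m → ℕ) : Type := (i : Fin m) → Fin (N i) → Sphere k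

/-- The joint distribution of `m` mutually independent samples, the `i`-th one consisting of `N i`
i.i.d. FvML points with concentration `conc v i` and location `loc v i`. -/
def sampleLaw {m k : ℕ} (N : Fin m → ℕ) (v : Vec m k) : Measure (Sample m k N) :=
  Measure.pi fun i => Measure.pi fun _ : Fin (N i) => fvml k (conc v i) (loc v i)

instance isProbabilityMeasure_sampleLaw {m k : ℕ} [k.AtLeastTwo] (N : Fin m → ℕ) (v : Vec m k) :
    IsProbabilityMeasure (sampleLaw N v) := by
  unfold sampleLaw
  infer_instance

/-- The residual `x - ⟪x, θ⟫ θ`. -/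
def residual {k : ℕ} (θ x : EuclideanSpace ℝ (Fin k)) : EuclideanSpace ℝ (Fin k) :=
  x - inner ℝ x θ • θ

/-- The spatial sign `S_θ(x) = (x - ⟪x, θ⟫ θ) / ‖x - ⟪x, θ⟫ θ‖` of the residual (set to `0` on the
null set where the residual vanishes). -/
def signS {k : ℕ} (θ x : EuclideanSpace ℝ (Fin k)) : EuclideanSpace ℝ (Fin k) :=
  ‖residual θ x‖⁻¹ • residual θ x

/-- The concentration part of the one-sample central sequence, for a sample of size `n`. -/
def centralI {k n : ℕ} (κ : ℝ) (θ : EuclideanSpace ℝ (Fin k)) (x : Fin n → Sphere k) : ℝ :=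
  (n : ℝ) ^ (-1 / 2 : ℝ) *
    ∑ j, (inner ℝ (x j : EuclideanSpace ℝ (Fin k)) θ - meanA k κ)

/-- The location part of the one-sample central sequence, for a sample of size `n`. -/
def centralII {k n : ℕ} (κ : ℝ) (θ : EuclideanSpace ℝ (Fin k)) (x : Fin n → Sphere k) :
    EuclideanSpace ℝ (Fin k) :=
  (κ * (n : ℝ) ^ (-1 / 2 : ℝ)) •
    ∑ j, (1 - (inner ℝ (x j : EuclideanSpace ℝ (Fin k)) θ) ^ 2) ^ (1 / 2 : ℝ) •
      signS θ (x j : EuclideanSpace ℝ (Fin k))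

/-- The `m`-sample central sequence. -/
def central {m k : ℕ} {N : Fin m → ℕ} (v : Vec m k) (x : Sample m k N) : Vec m k :=
  WithLp.toLp 2 (Sum.elim
    (fun i => centralI (conc v i) (loc v i) (x i))
    (fun p => centralII (conc v p.2) (loc v p.2) (x p.2) p.1))

/-- The one-sample Fisher information for the concentration. -/
def fisherI (k : ℕ) (κ : ℝ) : ℝ :=
  1 - ((k : ℝ) - 1) / κ * meanA k κ - meanA k κ ^ 2

/-- The one-sample Fisher information for the location. -/
def fisherII {k : ℕ} (κ : ℝ) (θ : EuclideanSpace ℝ (Fin k)) : Matrix (Fin k) (Fin k) ℝ :=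
  (κ ^ 2 * fisherJ k κ / ((k : ℝ) - 1)) • (1 - vecMulVec θ θ)

/-- The `m`-sample Fisher information, a block-diagonal matrix. -/
def fisher {m k : ℕ} (v : Vec m k) : Matrix (Idx m k) (Idx m k) ℝ :=
  fromBlocks
    (diagonal fun i => fisherI k (conc v i)) 0
    0 (blockDiagonal fun i => fisherII (conc v i) (loc v i))

/-- The matrix `diag(r₁^{-1/2}, …, r_m^{-1/2}, r₁^{-1/2} I_k, …, r_m^{-1/2} I_k)` with
`r_i = N_i / n`. -/
def scaleMatrix {m : ℕ} (k n : ℕ) (N : Fin m → ℕ) : Matrix (Idx m k) (Idx m k) ℝ :=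
  fromBlocks
    (diagonal fun i => ((N i : ℝ) / n) ^ (-1 / 2 : ℝ)) 0
    0 (blockDiagonal fun i => ((N i : ℝ) / n) ^ (-1 / 2 : ℝ) • (1 : Matrix (Fin k) (Fin k) ℝ))

/-- The locally perturbed parameter `v + n^{-1/2} ν τ`, where `ν` is the scaling matrix. -/
def perturb {m k : ℕ} (n : ℕ) (N : Fin m → ℕ) (v τ : Vec m k) : Vec m k :=
  v + (n : ℝ) ^ (-1 / 2 : ℝ) • (WithLp.toLp 2 (scaleMatrix k n N *ᵥ τ) : Vec m k)

/-- `R n = o_P(1)` under `P n`: convergence to zero in probability, along probability spaces that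
may vary with `n`. -/
def IsLittleOP {Ω : ℕ → Type*} [∀ n, MeasurableSpace (Ω n)] (P : ∀ n, Measure (Ω n))
    (R : ∀ n, Ω n → ℝ) : Prop :=
  ∀ ε : ℝ, 0 < ε → Tendsto (fun n => P n {x | ε ≤ |R n x|}) atTop (𝓝 0)

end

end FvML

/-!
The FvML laws on the sphere form an exponential family with natural parameter `κ • θ`, so the
log-likelihood ratio of a sample is a sum of linear functions of the observations minus increments
of the log-partition function, which depends only on `κ` because the surface measure is rotation
invariant. Since `θ` and `θ + a • u` both lie on the sphere, `⟪θ, u⟫ = -a * ‖u‖ ^ 2 / 2`: the local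
direction is tangent up to order `a`, and the second-order part of the ratio is a sample mean, which
Chebyshev's inequality replaces by its expectation. The log-partition function has first derivative
`A_k` and second derivative the concentration information, and a Taylor expansion that is uniform in
the base point yields the remaining quadratic term.

Rotation invariance also produces the Stein identities through which the moments of the FvML law are
expressed by the one-dimensional projected density, and thereby the information for the location.
Finally, the central sequence is a normalized sum of bounded, centred variables whose covariance
converges, and its characteristic function is a product of powers of the characteristic functions of
the single observations, so it converges to the Gaussian one.
-/

open scoped RealInnerProductSpace

namespace FvML

noncomputable section

lemma integrable_of_continuous_of_compactSpace {X F : Type*} [TopologicalSpace X] [CompactSpace X]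
    [MeasurableSpace X] [OpensMeasurableSpace X] [NormedAddCommGroup F] {μ : Measure X}
    [IsFiniteMeasureOnCompacts μ] {g : X → F} (hg : Continuous g) : Integrable g μ :=
  hg.integrable_of_hasCompactSupport (.of_compactSpace g)

section Sphere

variable {E : Type*} [NormedAddCommGroup E] [InnerProductSpace ℝ E] {θ e : E}

/-- The action of a linear isometry on the unit sphere. -/
def sphereHomeomorph (L : E ≃ₗᵢ[ℝ] E) :
    Metric.sphere (0 : E) 1 ≃ₜ Metric.sphere (0 : E) 1 :=
  L.toHomeomorph.subtype fun x => by simp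

open scoped Pointwise in
lemma Ioo_smul_image_preimage_sphereHomeomorph (L : E ≃ₗᵢ[ℝ] E)
    (s : Set (Metric.sphere (0 : E) 1)) :
    Set.Ioo (0 : ℝ) 1 • ((↑) '' (sphereHomeomorph L ⁻¹' s) : Set E)
      = L ⁻¹' (Set.Ioo (0 : ℝ) 1 • ((↑) '' s : Set E)) := by
  ext z
  simp only [Set.mem_smul, Set.mem_image, Set.mem_preimage]
  constructor
  · rintro ⟨r, hr, _, ⟨x, hx, rfl⟩, rfl⟩
    exact ⟨r, hr, _, ⟨_, hx, rfl⟩, (L.map_smul r x.1).symm⟩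
  · rintro ⟨r, hr, _, ⟨x, hx, rfl⟩, h⟩
    refine ⟨r, hr, _, ⟨(sphereHomeomorph L).symm x, by simpa using hx, rfl⟩, L.injective ?_⟩
    rw [← h, L.map_smul]
    exact congrArg (r • ·) (L.apply_symm_apply x.1)

lemma inner_reflection_singleton_right (hθ : ‖θ‖ = 1) (x y : E) :
    ⟪(ℝ ∙ θ).reflection x, y⟫ = 2 * ⟪x, θ⟫ * ⟪θ, y⟫ - ⟪x, y⟫ := by
  rw [Submodule.reflection_singleton_apply, hθ, inner_sub_left, ← Nat.cast_smul_eq_nsmul ℝ,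
    real_inner_smul_left, real_inner_smul_left, real_inner_comm θ x]
  simp [mul_assoc]

-- The isometry is the reflection in the line that halves the angle between `θ` and its image.
lemma exists_linearIsometryEquiv_inner_rotation (hθ : ‖θ‖ = 1) (he : ‖e‖ = 1)
    (hθe : ⟪θ, e⟫ = 0) (α : ℝ) :
    ∃ L : E ≃ₗᵢ[ℝ] E, ∀ x, ⟪L x, θ⟫ = ⟪x, θ⟫ * Real.cos α + ⟪x, e⟫ * Real.sin α ∧
      ⟪L x, e⟫ = ⟪x, θ⟫ * Real.sin α - ⟪x, e⟫ * Real.cos α := by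
  obtain ⟨β, rfl⟩ : ∃ β, α = 2 * β := ⟨α / 2, by ring⟩
  set u : E := Real.cos β • θ + Real.sin β • e with hu
  have hθθ : ⟪θ, θ⟫ = 1 := by rw [real_inner_self_eq_norm_sq, hθ, one_pow]
  have hee : ⟪e, e⟫ = 1 := by rw [real_inner_self_eq_norm_sq, he, one_pow]
  have huθ : ⟪u, θ⟫ = Real.cos β := by
    rw [hu, inner_add_left, real_inner_smul_left, real_inner_smul_left, hθθ, real_inner_comm, hθe]
    ring
  have hue : ⟪u, e⟫ = Real.sin β := by
    rw [hu, inner_add_left, real_inner_smul_left, real_inner_smul_left, hee, hθe]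
    ring
  have hxu (x : E) : ⟪x, u⟫ = Real.cos β * ⟪x, θ⟫ + Real.sin β * ⟪x, e⟫ := by
    rw [hu, inner_add_right, real_inner_smul_right, real_inner_smul_right]
  have hu1 : ‖u‖ = 1 := by
    rw [← sq_eq_sq₀ (norm_nonneg u) zero_le_one, ← real_inner_self_eq_norm_sq, hxu, huθ, hue]
    linear_combination Real.cos_sq_add_sin_sq β
  refine ⟨(ℝ ∙ u).reflection, fun x => ?_⟩
  rw [inner_reflection_singleton_right hu1, inner_reflection_singleton_right hu1, hxu, huθ, hue,
    Real.sin_two_mul, Real.cos_two_mul]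
  exact ⟨by ring, by linear_combination 2 * ⟪x, e⟫ * Real.sin_sq_add_cos_sq β⟩

lemma hasDerivAt_mul_rotation {f f' : ℝ → ℝ} (hf : ∀ t, HasDerivAt f (f' t) t) (a b α : ℝ) :
    HasDerivAt
      (fun α => f (a * Real.cos α + b * Real.sin α) * (a * Real.sin α - b * Real.cos α))
      (f (a * Real.cos α + b * Real.sin α) * (a * Real.cos α + b * Real.sin α)
        - f' (a * Real.cos α + b * Real.sin α) * (a * Real.sin α - b * Real.cos α) ^ 2) α := by
  have h₁ : HasDerivAt (fun α => a * Real.cos α + b * Real.sin α)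
      (-(a * Real.sin α - b * Real.cos α)) α :=
    (((Real.hasDerivAt_cos α).const_mul a).add ((Real.hasDerivAt_sin α).const_mul b)).congr_deriv
      (by ring)
  have h₂ : HasDerivAt (fun α => a * Real.sin α - b * Real.cos α)
      (a * Real.cos α + b * Real.sin α) α :=
    (((Real.hasDerivAt_sin α).const_mul a).sub ((Real.hasDerivAt_cos α).const_mul b)).congr_deriv
      (by ring)
  exact (((hf _).comp α h₁).mul h₂).congr_deriv (by simp only [Function.comp]; ring)

variable [FiniteDimensional ℝ E]

lemma finrank_orthogonal_span_singleton_of_norm_eq_one (hθ : ‖θ‖ = 1) :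
    (Module.finrank ℝ (ℝ ∙ θ)ᗮ : ℝ) = Module.finrank ℝ E - 1 := by
  have h := (ℝ ∙ θ).finrank_add_finrank_orthogonal
  rw [finrank_span_singleton (norm_ne_zero_iff.1 (hθ ▸ one_ne_zero))] at h
  rw [← h]
  push_cast
  ring

lemma sum_inner_stdOrthonormalBasis_orthogonal_sq (hθ : ‖θ‖ = 1) (x : E) :
    ∑ i, ⟪x, (stdOrthonormalBasis ℝ (ℝ ∙ θ)ᗮ i : E)⟫ ^ 2 = ‖x‖ ^ 2 - ⟪x, θ⟫ ^ 2 := by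
  have hparseval := (stdOrthonormalBasis ℝ (ℝ ∙ θ)ᗮ).sum_sq_inner_left
    ((ℝ ∙ θ)ᗮ.orthogonalProjectionOnto x)
  simp only [Submodule.inner_orthogonalProjectionOnto_eq_of_mem_right] at hparseval
  have hpythagoras := (ℝ ∙ θ).norm_sq_eq_add_norm_sq_starProjection x
  rw [Submodule.starProjection_unit_singleton ℝ hθ, norm_smul, hθ, mul_one, Real.norm_eq_abs,
    sq_abs, real_inner_comm, Submodule.starProjection_apply, ← Submodule.coe_norm,
    ← hparseval] at hpythagoras
  exact eq_sub_of_add_eq' hpythagoras.symm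

variable [MeasurableSpace E] [BorelSpace E]

lemma measurePreserving_sphereHomeomorph (L : E ≃ₗᵢ[ℝ] E) :
    MeasurePreserving (sphereHomeomorph L) (volume : Measure E).toSphere
      (volume : Measure E).toSphere := by
  have hL := (sphereHomeomorph L).continuous.measurable
  refine ⟨hL, Measure.ext fun s hs => ?_⟩
  rw [Measure.map_apply hL hs, Measure.toSphere_apply' _ hs, Measure.toSphere_apply' _ (hL hs),
    Ioo_smul_image_preimage_sphereHomeomorph]
  congr 1
  exact L.measurePreserving.measure_preimage_equiv (f := L.toHomeomorph.toMeasurableEquiv) _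

lemma integral_toSphere_comp_linearIsometryEquiv (L : E ≃ₗᵢ[ℝ] E) (g : E → ℝ) :
    ∫ x, g (L x.1) ∂(volume : Measure E).toSphere
      = ∫ x, g x.1 ∂(volume : Measure E).toSphere :=
  (measurePreserving_sphereHomeomorph L).integral_comp (sphereHomeomorph L).measurableEmbedding
    fun x => g x.1

lemma integral_toSphere_mul_inner_eq_zero (hθ : ‖θ‖ = 1) (hθe : ⟪θ, e⟫ = 0) (g : ℝ → ℝ) :
    ∫ x, g ⟪x.1, θ⟫ * ⟪x.1, e⟫ ∂(volume : Measure E).toSphere = 0 := by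
  have hθθ : ⟪θ, θ⟫ = 1 := by rw [real_inner_self_eq_norm_sq, hθ, one_pow]
  have h := integral_toSphere_comp_linearIsometryEquiv (ℝ ∙ θ).reflection
    fun x => g ⟪x, θ⟫ * ⟪x, e⟫
  simp only [inner_reflection_singleton_right hθ, hθθ, hθe, mul_one, mul_zero, zero_sub, two_mul,
    add_sub_cancel_right, mul_neg, integral_neg] at h
  exact self_eq_neg.1 h.symm

-- The integral of `f (cos α T + sin α Y) * (sin α T - cos α Y)` does not depend on `α`.
lemma integral_toSphere_deriv_mul_inner_sq (hθ : ‖θ‖ = 1) (he : ‖e‖ = 1) (hθe : ⟪θ, e⟫ = 0)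
    {f f' : ℝ → ℝ} (hf : ∀ t, HasDerivAt f (f' t) t) (hf' : Continuous f') :
    ∫ x, f' ⟪x.1, θ⟫ * ⟪x.1, e⟫ ^ 2 ∂(volume : Measure E).toSphere
      = ∫ x, f ⟪x.1, θ⟫ * ⟪x.1, θ⟫ ∂(volume : Measure E).toSphere := by
  set σ := (volume : Measure E).toSphere
  have hfc : Continuous f := continuous_iff_continuousAt.2 fun t => (hf t).continuousAt
  let F (α : ℝ) (x : Metric.sphere (0 : E) 1) : ℝ :=
    f (⟪x.1, θ⟫ * Real.cos α + ⟪x.1, e⟫ * Real.sin α)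
      * (⟪x.1, θ⟫ * Real.sin α - ⟪x.1, e⟫ * Real.cos α)
  let F' (α : ℝ) (x : Metric.sphere (0 : E) 1) : ℝ :=
    f (⟪x.1, θ⟫ * Real.cos α + ⟪x.1, e⟫ * Real.sin α)
        * (⟪x.1, θ⟫ * Real.cos α + ⟪x.1, e⟫ * Real.sin α)
      - f' (⟪x.1, θ⟫ * Real.cos α + ⟪x.1, e⟫ * Real.sin α)
        * (⟪x.1, θ⟫ * Real.sin α - ⟪x.1, e⟫ * Real.cos α) ^ 2
  have hF (α : ℝ) : Continuous (F α) := by fun_prop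
  have hF' : Continuous fun p : ℝ × Metric.sphere (0 : E) 1 => F' p.1 p.2 := by fun_prop
  have hint {g : Metric.sphere (0 : E) 1 → ℝ} (hg : Continuous g) : Integrable g σ :=
    integrable_of_continuous_of_compactSpace hg
  obtain ⟨C, hC⟩ := (isCompact_Icc (a := (-1 : ℝ)) (b := 1)).prod isCompact_univ
    |>.exists_bound_of_continuousOn hF'.continuousOn
  have hderiv := (hasDerivAt_integral_of_dominated_loc_of_deriv_le (μ := σ)
    (Icc_mem_nhds (by norm_num : (-1 : ℝ) < 0) zero_lt_one)
    (Eventually.of_forall fun α => (hF α).aestronglyMeasurable) (hint (hF 0))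
    (hF'.comp (Continuous.prodMk_right 0)).aestronglyMeasurable
    (Eventually.of_forall fun x α hα => hC (α, x) ⟨hα, Set.mem_univ x⟩) (integrable_const C)
    (Eventually.of_forall fun x α _ => hasDerivAt_mul_rotation hf ⟪x.1, θ⟫ ⟪x.1, e⟫ α)).2
  have hconst (α : ℝ) : ∫ x, F α x ∂σ = ∫ x, f ⟪x.1, θ⟫ * ⟪x.1, e⟫ ∂σ := by
    obtain ⟨L, hL⟩ := exists_linearIsometryEquiv_inner_rotation hθ he hθe α
    simpa only [hL] using
      integral_toSphere_comp_linearIsometryEquiv L fun x => f ⟪x, θ⟫ * ⟪x, e⟫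
  have hzero := ((hasDerivAt_const 0 _).congr_of_eventuallyEq (.of_forall hconst)).unique hderiv
  simp only [F', Real.cos_zero, Real.sin_zero, mul_one, mul_zero, add_zero, zero_sub, neg_sq]
    at hzero
  rw [integral_sub (hint (by fun_prop)) (hint (by fun_prop)), eq_comm, sub_eq_zero] at hzero
  exact hzero.symm

lemma integral_toSphere_deriv_mul_one_sub_inner_sq (hθ : ‖θ‖ = 1) {f f' : ℝ → ℝ}
    (hf : ∀ t, HasDerivAt f (f' t) t) (hf' : Continuous f') :
    ∫ x, f' ⟪x.1, θ⟫ * (1 - ⟪x.1, θ⟫ ^ 2) ∂(volume : Measure E).toSphere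
      = (Module.finrank ℝ E - 1) * ∫ x, f ⟪x.1, θ⟫ * ⟪x.1, θ⟫ ∂(volume : Measure E).toSphere := by
  let b := stdOrthonormalBasis ℝ (ℝ ∙ θ)ᗮ
  have hθb i : ⟪θ, (b i : E)⟫ = 0 := Submodule.mem_orthogonal_singleton_iff_inner_right.1 (b i).2
  have hsum (x : Metric.sphere (0 : E) 1) : 1 - ⟪x.1, θ⟫ ^ 2 = ∑ i, ⟪x.1, (b i : E)⟫ ^ 2 := by
    rw [sum_inner_stdOrthonormalBasis_orthogonal_sq hθ, norm_eq_of_mem_sphere, one_pow]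
  simp_rw [hsum, Finset.mul_sum]
  rw [integral_finsetSum _ fun i _ => integrable_of_continuous_of_compactSpace (by fun_prop)]
  have hterm i := integral_toSphere_deriv_mul_inner_sq (e := (b i : E)) hθ (b.orthonormal.1 i)
    (hθb i) hf hf'
  simp_rw [hterm]
  simp [finrank_orthogonal_span_singleton_of_norm_eq_one hθ]

end Sphere

section Moments

lemma eq_of_forall_integral_pow_eq {μ ν : Measure ℝ} [IsFiniteMeasure μ] [IsFiniteMeasure ν]
    {a b : ℝ} (hμ : ∀ᵐ t ∂μ, t ∈ Set.Icc a b) (hν : ∀ᵐ t ∂ν, t ∈ Set.Icc a b)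
    (h : ∀ n : ℕ, ∫ t, t ^ n ∂μ = ∫ t, t ^ n ∂ν) : μ = ν := by
  have hint {ρ : Measure ℝ} [IsFiniteMeasure ρ] (hρ : ∀ᵐ t ∂ρ, t ∈ Set.Icc a b) {f : ℝ → ℝ}
      (hf : Continuous f) : Integrable f ρ := by
    obtain ⟨C, hC⟩ :=
      isCompact_Icc.exists_bound_of_continuousOn (hf.continuousOn (s := Set.Icc a b))
    exact .of_bound hf.aestronglyMeasurable C (hρ.mono hC)
  have hpoly (q : Polynomial ℝ) : ∫ t, q.eval t ∂μ = ∫ t, q.eval t ∂ν := by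
    simp_rw [Polynomial.eval_eq_sum_range]
    rw [integral_finsetSum _ fun n _ => hint hμ (by fun_prop),
      integral_finsetSum _ fun n _ => hint hν (by fun_prop)]
    simp_rw [integral_const_mul, h]
  refine ext_of_forall_integral_eq_of_IsFiniteMeasure fun f => ?_
  have happrox {ρ : Measure ℝ} [IsFiniteMeasure ρ] (hρ : ∀ᵐ t ∂ρ, t ∈ Set.Icc a b)
      {q : Polynomial ℝ} {ε : ℝ} (hq : ∀ t ∈ Set.Icc a b, |q.eval t - f t| < ε) :
      |∫ t, q.eval t ∂ρ - ∫ t, f t ∂ρ| ≤ ε * ρ.real Set.univ := by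
    rw [← integral_sub (hint hρ (by fun_prop)) (hint hρ f.continuous)]
    exact norm_integral_le_of_norm_le_const (f := fun t => q.eval t - f t)
      (hρ.mono fun t ht => (hq t ht).le)
  refine eq_of_forall_dist_le fun ε hε => ?_
  have hpos : 0 < μ.real Set.univ + ν.real Set.univ + 1 := by positivity
  obtain ⟨q, hq⟩ := exists_polynomial_near_of_continuousOn a b f f.continuous.continuousOn _
    (div_pos hε hpos)
  have hμq := happrox hμ hq
  have hνq := happrox hν hq
  rw [hpoly] at hμq
  calc dist (∫ t, f t ∂μ) (∫ t, f t ∂ν)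
      ≤ ε / (μ.real Set.univ + ν.real Set.univ + 1) * μ.real Set.univ
        + ε / (μ.real Set.univ + ν.real Set.univ + 1) * ν.real Set.univ := by
        rw [abs_sub_comm] at hμq
        exact (abs_sub_le _ _ _).trans (add_le_add hμq hνq)
    _ ≤ ε := by
        rw [← mul_add, div_mul_eq_mul_div, div_le_iff₀ hpos]
        linarith

/-- The Stein identity, on monomials, which characterizes up to a factor the measure on `[-1, 1]`
with density `(1 - t²)^(c / 2 - 1)`. -/
def IsGegenbauerStein (c : ℝ) (μ : Measure ℝ) : Prop :=
  ∀ n : ℕ, ∫ t, n * t ^ (n - 1) * (1 - t ^ 2) ∂μ = c * ∫ t, t ^ n * t ∂μ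

namespace IsGegenbauerStein

variable {c : ℝ} {μ ν : Measure ℝ}

lemma integral_id_eq_zero (h : IsGegenbauerStein c μ) (hc : 0 < c) : ∫ t, t ∂μ = 0 := by
  simpa [hc.ne'] using (h 0).symm

variable [IsFiniteMeasure μ] [IsFiniteMeasure ν]

lemma integral_pow_add_two (h : IsGegenbauerStein c μ) (hμ : ∀ᵐ t ∂μ, t ∈ Set.Icc (-1) 1)
    (n : ℕ) : (c + n + 1) * ∫ t, t ^ (n + 2) ∂μ = (n + 1) * ∫ t, t ^ n ∂μ := by
  have hint (j : ℕ) : Integrable (fun t => t ^ j) μ :=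
    .of_bound (by fun_prop) 1 <| hμ.mono fun t ht => by
      simpa using pow_le_one₀ (abs_nonneg t) (abs_le.2 ht)
  have hn := h (n + 1)
  have hlhs : (fun t : ℝ => ((n + 1 : ℕ) : ℝ) * t ^ (n + 1 - 1) * (1 - t ^ 2))
      = fun t : ℝ => (n + 1 : ℝ) * (t ^ n - t ^ (n + 2)) := by
    ext t
    push_cast [Nat.add_sub_cancel]
    ring
  rw [hlhs, integral_const_mul, integral_sub (hint _) (hint _)] at hn
  simp only [← pow_succ] at hn
  linarith

lemma smul_measure_univ_eq (hμs : IsGegenbauerStein c μ) (hνs : IsGegenbauerStein c ν)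
    (hc : 0 < c) (hμ : ∀ᵐ t ∂μ, t ∈ Set.Icc (-1) 1) (hν : ∀ᵐ t ∂ν, t ∈ Set.Icc (-1) 1) :
    ν Set.univ • μ = μ Set.univ • ν := by
  have hmom : ∀ n : ℕ, ν.real Set.univ * ∫ t, t ^ n ∂μ = μ.real Set.univ * ∫ t, t ^ n ∂ν :=
    Nat.twoStepInduction (by simp [mul_comm])
      (by simp [hμs.integral_id_eq_zero hc, hνs.integral_id_eq_zero hc]) fun n ih _ => by
        refine mul_left_cancel₀ (a := c + n + 1) (by positivity) ?_
        linear_combination ν.real Set.univ * hμs.integral_pow_add_two hμ n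
          - μ.real Set.univ * hνs.integral_pow_add_two hν n + (n + 1) * ih
  have := μ.smul_finite (measure_ne_top ν Set.univ)
  have := ν.smul_finite (measure_ne_top μ Set.univ)
  refine eq_of_forall_integral_pow_eq (Measure.ae_smul_measure hμ _)
    (Measure.ae_smul_measure hν _) fun n => ?_
  simpa only [integral_smul_measure] using! hmom n

end IsGegenbauerStein

end Moments

section Gegenbauer

variable {p : ℝ}

/-- The measure on `[-1, 1]` with the Gegenbauer weight `(1 - t²)^p` as density. For
`p = (k - 3) / 2` it is, up to a factor, the projection on a line of the surface measure of
`S^{k-1}`. -/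
def gegenbauerMeasure (p : ℝ) : Measure ℝ :=
  (volume.restrict (Set.Ioc (-1) 1)).withDensity fun t => ENNReal.ofReal ((1 - t ^ 2) ^ p)

lemma intervalIntegrable_one_sub_sq_rpow (hp : -1 < p) :
    IntervalIntegrable (fun t : ℝ => (1 - t ^ 2) ^ p) volume (-1) 1 := by
  have hright : IntervalIntegrable (fun t : ℝ => (1 - t ^ 2) ^ p) volume 0 1 := by
    have hsub : IntervalIntegrable (fun t : ℝ => (1 - t) ^ p) volume 0 1 := by
      simpa using ((intervalIntegral.intervalIntegrable_rpow' hp (a := 0) (b := 1)).comp_sub_left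
        1).symm
    have hadd : ContinuousOn (fun t : ℝ => (1 + t) ^ p) (Set.uIcc 0 1) := by
      rw [Set.uIcc_of_le zero_le_one]
      exact ContinuousOn.rpow_const (by fun_prop) fun t ht => .inl (by linarith [ht.1])
    refine (hsub.mul_continuousOn hadd).congr fun t ht => ?_
    rw [Set.uIoc_of_le zero_le_one] at ht
    rw [← Real.mul_rpow (by linarith [ht.2]) (by linarith [ht.1])]
    congr 1
    ring
  refine IntervalIntegrable.trans ?_ hright
  simpa using ((IntervalIntegrable.iff_comp_neg (by simp)).1 hright).symm

lemma ae_mem_Icc_gegenbauerMeasure : ∀ᵐ t ∂gegenbauerMeasure p, t ∈ Set.Icc (-1) 1 :=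
  withDensity_absolutelyContinuous _ _ |>.ae_le <|
    (ae_restrict_mem measurableSet_Ioc).mono fun _ ht => Set.Ioc_subset_Icc_self ht

lemma integral_gegenbauerMeasure (g : ℝ → ℝ) :
    ∫ t, g t ∂gegenbauerMeasure p = ∫ t in (-1 : ℝ)..1, g t * (1 - t ^ 2) ^ p := by
  rw [gegenbauerMeasure, integral_withDensity_eq_integral_toReal_smul (by fun_prop) (by simp),
    intervalIntegral.integral_of_le (by norm_num)]
  refine setIntegral_congr_fun measurableSet_Ioc fun t ht => ?_
  have : 0 ≤ 1 - t ^ 2 := by nlinarith [ht.1, ht.2]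
  rw [ENNReal.toReal_ofReal (by positivity), smul_eq_mul, mul_comm]

lemma isFiniteMeasure_gegenbauerMeasure (hp : -1 < p) :
    IsFiniteMeasure (gegenbauerMeasure p) :=
  isFiniteMeasure_withDensity_ofReal
    ((intervalIntegrable_iff_integrableOn_Ioc_of_le (by norm_num)).1
      (intervalIntegrable_one_sub_sq_rpow hp)).2

lemma gegenbauerMeasure_ne_zero (hp : -1 < p) : gegenbauerMeasure p ≠ 0 := by
  have hpos : 0 < ∫ t in (-1 : ℝ)..1, (1 - t ^ 2) ^ p :=
    intervalIntegral.intervalIntegral_pos_of_pos_on (intervalIntegrable_one_sub_sq_rpow hp)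
      (fun t ht => Real.rpow_pos_of_pos (by nlinarith [ht.1, ht.2]) p) (by norm_num)
  intro h
  simpa [h, hpos.ne] using integral_gegenbauerMeasure (p := p) fun _ => 1

lemma integral_deriv_mul_one_sub_sq_gegenbauerMeasure (hp : -1 < p) {f f' : ℝ → ℝ}
    (hf : ∀ t, HasDerivAt f (f' t) t) (hf' : Continuous f') :
    ∫ t, f' t * (1 - t ^ 2) ∂gegenbauerMeasure p
      = 2 * (p + 1) * ∫ t, f t * t ∂gegenbauerMeasure p := by
  have hfc : Continuous f := continuous_iff_continuousAt.2 fun t => (hf t).continuousAt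
  have hpow (t : ℝ) (ht : t ∈ Set.Ioo (min (-1) 1) (max (-1) 1)) :
      HasDerivAt (fun t : ℝ => (1 - t ^ 2) ^ (p + 1)) (-(2 * (p + 1)) * t * (1 - t ^ 2) ^ p) t := by
    norm_num at ht
    have := ((hasDerivAt_pow 2 t).const_sub 1).rpow_const (p := p + 1)
      (.inl (by nlinarith [ht.1, ht.2]))
    convert this using 1
    rw [add_sub_cancel_right]
    push_cast
    ring
  have hparts := intervalIntegral.integral_mul_deriv_eq_deriv_mul_of_hasDerivAt
    hfc.continuousOn (ContinuousOn.rpow_const (by fun_prop) fun _ _ => .inr (by linarith))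
    (fun t _ => hf t) hpow (hf'.intervalIntegrable _ _)
    ((intervalIntegrable_one_sub_sq_rpow hp).continuousOn_mul (by fun_prop))
  have hboundary : (1 - (-1 : ℝ) ^ 2) ^ (p + 1) = 0 ∧ (1 - (1 : ℝ) ^ 2) ^ (p + 1) = 0 := by
    norm_num [Real.zero_rpow, (by linarith : p + 1 ≠ 0)]
  rw [hboundary.1, hboundary.2, mul_zero, mul_zero, sub_zero, zero_sub] at hparts
  simp only [integral_gegenbauerMeasure]
  rw [← intervalIntegral.integral_const_mul]
  calc ∫ t in (-1 : ℝ)..1, f' t * (1 - t ^ 2) * (1 - t ^ 2) ^ p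
      = ∫ t in (-1 : ℝ)..1, f' t * (1 - t ^ 2) ^ (p + 1) := by
        refine intervalIntegral.integral_congr fun t ht => ?_
        rw [Set.uIcc_of_le (by norm_num)] at ht
        have : 0 ≤ 1 - t ^ 2 := by nlinarith [ht.1, ht.2]
        rw [Real.rpow_add_one' this (by linarith)]
        ring
    _ = -∫ t in (-1 : ℝ)..1, f t * (-(2 * (p + 1)) * t * (1 - t ^ 2) ^ p) := by
        rw [hparts, neg_neg]
    _ = ∫ t in (-1 : ℝ)..1, 2 * (p + 1) * (f t * t * (1 - t ^ 2) ^ p) := by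
        rw [← intervalIntegral.integral_neg]
        exact intervalIntegral.integral_congr fun t _ => by ring

lemma isGegenbauerStein_gegenbauerMeasure (hp : -1 < p) :
    IsGegenbauerStein (2 * (p + 1)) (gegenbauerMeasure p) := fun n =>
  integral_deriv_mul_one_sub_sq_gegenbauerMeasure hp (hasDerivAt_pow n) (by fun_prop)

end Gegenbauer

section Tilted

variable {α β : Type*} [MeasurableSpace α] [MeasurableSpace β] {μ : Measure α}

lemma smul_measure_tilted {c : ENNReal} (hc : c ≠ 0) (hc' : c ≠ ⊤) (f : α → ℝ) :
    (c • μ).tilted f = μ.tilted f := by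
  rw [Measure.tilted, withDensity_smul_measure, integral_smul_measure, Measure.tilted,
    ← withDensity_smul' _ _ hc']
  congr 1
  ext x
  simp only [Pi.smul_apply, smul_eq_mul]
  rw [div_mul_eq_div_div_swap, ENNReal.ofReal_div_of_pos (ENNReal.toReal_pos hc hc'),
    ENNReal.ofReal_toReal hc', ENNReal.mul_div_cancel hc hc']

lemma map_tilted_comp {T : α → β} (hT : Measurable T) {f : β → ℝ} (hf : Measurable f) :
    (μ.tilted (f ∘ T)).map T = (μ.map T).tilted f := by
  ext s hs
  rw [Measure.map_apply hT hs, tilted_apply' _ _ (hT hs), tilted_apply' _ _ hs,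
    setLIntegral_map hs (by fun_prop) hT, integral_map hT.aemeasurable (by fun_prop)]
  rfl

lemma pi_tilted {ι : Type*} [Fintype ι] {α : ι → Type*} [∀ i, MeasurableSpace (α i)]
    (μ : ∀ i, Measure (α i)) [∀ i, SigmaFinite (μ i)] (f : ∀ i, α i → ℝ) :
    Measure.pi (fun i => (μ i).tilted (f i)) = (Measure.pi μ).tilted fun x => ∑ i, f i (x i) := by
  refine Measure.pi_eq fun s hs => ?_
  simp_rw [tilted_apply_eq_ofReal_integral' _ (MeasurableSet.univ_pi hs), Measure.restrict_pi_pi,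
    Real.exp_sum, integral_fintype_prod_eq_prod (fun i (x : α i) => Real.exp (f i x)),
    ← Finset.prod_div_distrib, tilted_apply_eq_ofReal_integral' _ (hs _)]
  rw [integral_fintype_prod_eq_prod (μ := fun i => (μ i).restrict (s i))
    (fun i (x : α i) => Real.exp (f i x) / ∫ x, Real.exp (f i x) ∂μ i),
    ENNReal.ofReal_prod_of_nonneg fun i _ => integral_nonneg fun x => by positivity]

end Tilted

section BoundedExponentialFamily

variable {μ : Measure ℝ} [IsFiniteMeasure μ] {a b : ℝ}

lemma integrableExpSet_id_eq_univ_of_mem_Icc (hμ : ∀ᵐ t ∂μ, t ∈ Set.Icc a b) :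
    integrableExpSet id μ = Set.univ :=
  Set.eq_univ_of_forall fun _ => integrable_exp_mul_of_mem_Icc aemeasurable_id hμ

lemma hasDerivAt_cgf_id_of_mem_Icc (hμ : ∀ᵐ t ∂μ, t ∈ Set.Icc a b) (κ : ℝ) :
    HasDerivAt (cgf id μ) (∫ t, t ∂μ.tilted (κ * ·)) κ := by
  have hκ : κ ∈ interior (integrableExpSet id μ) := by
    simp [integrableExpSet_id_eq_univ_of_mem_Icc hμ]
  exact (integral_tilted_mul_self hκ) ▸ (analyticAt_cgf hκ).differentiableAt.hasDerivAt

lemma hasStrictDerivAt_integral_tilted_of_mem_Icc (hμ : ∀ᵐ t ∂μ, t ∈ Set.Icc a b) (κ : ℝ) :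
    HasStrictDerivAt (fun κ => ∫ t, t ∂μ.tilted (κ * ·)) Var[id; μ.tilted (κ * ·)] κ := by
  have hint (κ : ℝ) : κ ∈ interior (integrableExpSet id μ) := by
    simp [integrableExpSet_id_eq_univ_of_mem_Icc hμ]
  have hmean : (fun κ => ∫ t, t ∂μ.tilted (κ * ·)) = deriv (cgf id μ) :=
    funext fun κ => (hasDerivAt_cgf_id_of_mem_Icc hμ κ).deriv.symm
  have hvar := variance_tilted_mul (hint κ)
  simp only [id_eq] at hvar
  rw [hmean, hvar, iteratedDeriv_succ, iteratedDeriv_one]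
  exact (analyticAt_cgf (hint κ)).deriv.hasStrictDerivAt

end BoundedExponentialFamily

section ProjectedLaw

variable {k : ℕ} {θ : EuclideanSpace ℝ (Fin k)}

/-- The measure with density `(1 - t²)^((k - 3) / 2)` on `[-1, 1]`, proportional to the projection
of the surface measure of `S^{k-1}` on a line. -/
def projMeasure (k : ℕ) : Measure ℝ := gegenbauerMeasure (((k : ℝ) - 3) / 2)

/-- The logarithm of the normalizing constant of the projected FvML density. -/
def logPartition (k : ℕ) : ℝ → ℝ := cgf id (projMeasure k)

lemma ae_mem_Icc_projMeasure : ∀ᵐ t ∂projMeasure k, t ∈ Set.Icc (-1) 1 :=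
  ae_mem_Icc_gegenbauerMeasure

lemma integral_tilted_projMeasure (κ : ℝ) (g : ℝ → ℝ) :
    ∫ t, g t ∂(projMeasure k).tilted (κ * ·)
      = (∫ t in (-1 : ℝ)..1, g t * projWeight k κ t) / ∫ t in (-1 : ℝ)..1, projWeight k κ t := by
  have hweight (h : ℝ → ℝ) : ∫ t, Real.exp (κ * t) * h t ∂projMeasure k
      = ∫ t in (-1 : ℝ)..1, h t * projWeight k κ t := by
    rw [projMeasure, integral_gegenbauerMeasure]
    refine intervalIntegral.integral_congr fun t _ => ?_
    rw [projWeight]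
    ring
  have hnorm := hweight fun _ => 1
  simp only [mul_one, one_mul] at hnorm
  rw [integral_tilted, hnorm, ← hweight, ← integral_div]
  simp only [smul_eq_mul, div_mul_eq_mul_div]

lemma meanA_eq_integral_tilted (κ : ℝ) :
    meanA k κ = ∫ t, t ∂(projMeasure k).tilted (κ * ·) :=
  (integral_tilted_projMeasure κ _).symm

lemma fisherJ_eq_integral_tilted (κ : ℝ) :
    fisherJ k κ = ∫ t, 1 - t ^ 2 ∂(projMeasure k).tilted (κ * ·) := by
  rw [integral_tilted_projMeasure, fisherJ, ← intervalIntegral.integral_div]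
  simp only [projDensity, mul_div_assoc]

lemma abs_inner_sphere_le (x : Sphere k) (u : EuclideanSpace ℝ (Fin k)) : |⟪x.1, u⟫| ≤ ‖u‖ := by
  simpa using abs_real_inner_le_norm x.1 u

instance : IsFiniteMeasure (surfaceMeasure k) :=
  inferInstanceAs (IsFiniteMeasure (volume : Measure (EuclideanSpace ℝ (Fin k))).toSphere)

variable [k.AtLeastTwo]

variable (k) in
lemma neg_one_lt_sub_three_div_two : -1 < ((k : ℝ) - 3) / 2 := by
  have : (2 : ℝ) ≤ k := by exact_mod_cast Nat.AtLeastTwo.prop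
  linarith

instance : IsFiniteMeasure (projMeasure k) :=
  isFiniteMeasure_gegenbauerMeasure (neg_one_lt_sub_three_div_two k)

instance : NeZero (projMeasure k) :=
  ⟨gegenbauerMeasure_ne_zero (neg_one_lt_sub_three_div_two k)⟩

instance : NeZero (surfaceMeasure k) := ⟨by
  have : Nonempty (Fin k) := ⟨0⟩
  simp [surfaceMeasure]⟩

lemma mul_fisherJ (κ : ℝ) : κ * fisherJ k κ = (k - 1) * meanA k κ := by
  have hstein := integral_deriv_mul_one_sub_sq_gegenbauerMeasure (neg_one_lt_sub_three_div_two k)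
    (fun t => ((hasDerivAt_id t).const_mul κ).exp) (by fun_prop)
  rw [fisherJ_eq_integral_tilted, meanA_eq_integral_tilted]
  simp only [integral_tilted, div_eq_inv_mul, smul_eq_mul, mul_assoc, integral_const_mul]
  simp only [id_eq, mul_one, mul_comm _ κ, mul_assoc,
    integral_const_mul] at hstein
  rw [mul_left_comm, projMeasure, hstein]
  ring

lemma variance_tilted_projMeasure {κ : ℝ} (hκ : κ ≠ 0) :
    Var[id; (projMeasure k).tilted (κ * ·)] = fisherI k κ := by
  have hint : κ ∈ interior (integrableExpSet id (projMeasure k)) := by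
    simp [integrableExpSet_id_eq_univ_of_mem_Icc ae_mem_Icc_projMeasure]
  have : IsProbabilityMeasure ((projMeasure k).tilted (κ * ·)) := isProbabilityMeasure_tilted
    (integrable_exp_mul_of_mem_Icc aemeasurable_id ae_mem_Icc_projMeasure)
  have hLp : MemLp id 2 ((projMeasure k).tilted (κ * ·)) := memLp_tilted_mul hint 2
  have hJ : 1 - ∫ t, t ^ 2 ∂(projMeasure k).tilted (κ * ·) = fisherJ k κ := by
    rw [fisherJ_eq_integral_tilted, integral_sub (integrable_const 1) (by exact hLp.integrable_sq)]
    simp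
  have hκJ := mul_fisherJ (k := k) κ
  rw [variance_eq_sub hLp]
  simp only [Pi.pow_apply, id_eq]
  rw [← meanA_eq_integral_tilted, ← sub_eq_iff_eq_add'.2 (sub_eq_iff_eq_add.1 hJ), fisherI]
  field_simp
  linear_combination -hκJ

lemma hasDerivAt_logPartition (κ : ℝ) : HasDerivAt (logPartition k) (meanA k κ) κ :=
  meanA_eq_integral_tilted (k := k) κ ▸ hasDerivAt_cgf_id_of_mem_Icc ae_mem_Icc_projMeasure κ

lemma hasStrictDerivAt_meanA {κ : ℝ} (hκ : κ ≠ 0) :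
    HasStrictDerivAt (meanA k) (fisherI k κ) κ := by
  rw [funext meanA_eq_integral_tilted, ← variance_tilted_projMeasure hκ]
  exact hasStrictDerivAt_integral_tilted_of_mem_Icc ae_mem_Icc_projMeasure κ

lemma smul_map_inner_surfaceMeasure (hθ : ‖θ‖ = 1) :
    projMeasure k Set.univ • (surfaceMeasure k).map (fun x => ⟪x.1, θ⟫)
      = surfaceMeasure k Set.univ • projMeasure k := by
  have hmeas : Measurable fun x : Sphere k => ⟪x.1, θ⟫ := by fun_prop
  have huniv : surfaceMeasure k Set.univ = (surfaceMeasure k).map (fun x => ⟪x.1, θ⟫) Set.univ := by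
    rw [Measure.map_apply hmeas .univ, Set.preimage_univ]
  rw [huniv]
  have hp : 0 < 2 * (((k : ℝ) - 3) / 2 + 1) := by linarith [neg_one_lt_sub_three_div_two k]
  refine IsGegenbauerStein.smul_measure_univ_eq (fun n => ?_)
    (isGegenbauerStein_gegenbauerMeasure (neg_one_lt_sub_three_div_two k)) hp ?_
    ae_mem_Icc_projMeasure
  · rw [integral_map hmeas.aemeasurable (by fun_prop),
      integral_map hmeas.aemeasurable (by fun_prop)]
    refine (integral_toSphere_deriv_mul_one_sub_inner_sq hθ (hasDerivAt_pow n)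
      (by fun_prop)).trans ?_
    rw [finrank_euclideanSpace_fin]
    congr 1
    ring
  · refine (ae_map_iff hmeas.aemeasurable measurableSet_Icc).2 ?_
    exact .of_forall fun x => abs_le.1 (by simpa [hθ] using abs_inner_sphere_le x θ)

lemma map_inner_fvml (hθ : ‖θ‖ = 1) (κ : ℝ) :
    (fvml k κ θ).map (fun x => ⟪x.1, θ⟫) = (projMeasure k).tilted (κ * ·) := by
  have hne {α : Type} [MeasurableSpace α] (μ : Measure α) [IsFiniteMeasure μ] [NeZero μ] :
      μ Set.univ ≠ 0 ∧ μ Set.univ ≠ ⊤ :=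
    ⟨Measure.measure_univ_ne_zero.2 (NeZero.ne μ), measure_ne_top μ _⟩
  calc (fvml k κ θ).map (fun x => ⟪x.1, θ⟫)
      = ((surfaceMeasure k).map fun x => ⟪x.1, θ⟫).tilted (κ * ·) :=
        map_tilted_comp (by fun_prop) (by fun_prop)
    _ = (surfaceMeasure k Set.univ • projMeasure k).tilted (κ * ·) := by
        rw [← smul_map_inner_surfaceMeasure hθ, smul_measure_tilted (hne _).1 (hne _).2]
    _ = (projMeasure k).tilted (κ * ·) := smul_measure_tilted (hne _).1 (hne _).2 _

lemma integral_exp_mul_inner_surfaceMeasure (hθ : ‖θ‖ = 1) (κ : ℝ) :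
    ∫ x, Real.exp (κ * ⟪x.1, θ⟫) ∂surfaceMeasure k
      = (surfaceMeasure k).real Set.univ / (projMeasure k).real Set.univ
        * Real.exp (logPartition k κ) := by
  have hmgf := congrArg (mgf id · κ) (smul_map_inner_surfaceMeasure hθ)
  rw [mgf_smul_measure, mgf_smul_measure, mgf_id_map (by fun_prop)] at hmgf
  have hpos : 0 < (projMeasure k).real Set.univ := measureReal_univ_pos
  rw [logPartition, exp_cgf (integrable_exp_mul_of_mem_Icc aemeasurable_id ae_mem_Icc_projMeasure),
    div_mul_eq_mul_div, eq_div_iff hpos.ne', mul_comm]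
  exact hmgf

end ProjectedLaw

section OneObservation

variable {k : ℕ} {κ κ' : ℝ} {θ θ' e : EuclideanSpace ℝ (Fin k)}

lemma integral_fvml (κ : ℝ) (θ : EuclideanSpace ℝ (Fin k)) (g : Sphere k → ℝ) :
    ∫ x, g x ∂fvml k κ θ = (∫ x, Real.exp (κ * ⟪x.1, θ⟫) * g x ∂surfaceMeasure k)
      / ∫ x, Real.exp (κ * ⟪x.1, θ⟫) ∂surfaceMeasure k := by
  rw [fvml, integral_tilted, ← integral_div]
  simp only [smul_eq_mul, div_mul_eq_mul_div]

lemma inner_residual_eq_zero (hθ : ‖θ‖ = 1) (u : EuclideanSpace ℝ (Fin k)) :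
    ⟪θ, residual θ u⟫ = 0 := by
  rw [residual, inner_sub_right, real_inner_smul_right, real_inner_self_eq_norm_sq, hθ,
    real_inner_comm]
  ring

lemma integral_fvml_mul_inner_eq_zero (hθ : ‖θ‖ = 1) (hθe : ⟪θ, e⟫ = 0) (κ : ℝ) (g : ℝ → ℝ) :
    ∫ x, g ⟪x.1, θ⟫ * ⟪x.1, e⟫ ∂fvml k κ θ = 0 := by
  have h := integral_toSphere_mul_inner_eq_zero hθ hθe fun t => Real.exp (κ * t) * g t
  simp only [mul_assoc] at h
  rw [integral_fvml, surfaceMeasure, h, zero_div]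

lemma fvml_eq_tilted (κ κ' : ℝ) (θ θ' : EuclideanSpace ℝ (Fin k)) :
    fvml k κ' θ' = (fvml k κ θ).tilted fun x => ⟪x.1, κ' • θ' - κ • θ⟫ := by
  rw [fvml, fvml, tilted_tilted (integrable_of_continuous_of_compactSpace (by fun_prop))]
  congr 1
  ext x
  simp [inner_sub_right, real_inner_smul_right]

variable [k.AtLeastTwo]

lemma integral_fvml_inner_self (hθ : ‖θ‖ = 1) (κ : ℝ) :
    ∫ x, ⟪x.1, θ⟫ ∂fvml k κ θ = meanA k κ := by
  rw [meanA_eq_integral_tilted, ← map_inner_fvml hθ,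
    integral_map (by fun_prop) (by fun_prop)]

lemma integral_fvml_inner_sub_meanA_sq (hθ : ‖θ‖ = 1) (hκ : κ ≠ 0) :
    ∫ x, (⟪x.1, θ⟫ - meanA k κ) ^ 2 ∂fvml k κ θ = fisherI k κ := by
  rw [← variance_tilted_projMeasure hκ, ← map_inner_fvml hθ,
    variance_map aemeasurable_id (by fun_prop), variance_eq_integral (by fun_prop)]
  simp only [Function.comp_apply, id_eq, integral_fvml_inner_self hθ]

lemma integral_fvml_inner (hθ : ‖θ‖ = 1) (κ : ℝ) (c : EuclideanSpace ℝ (Fin k)) :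
    ∫ x, ⟪x.1, c⟫ ∂fvml k κ θ = meanA k κ * ⟪θ, c⟫ := by
  have hodd := integral_fvml_mul_inner_eq_zero hθ (inner_residual_eq_zero hθ c) κ fun _ => 1
  simp only [one_mul, residual, inner_sub_right, real_inner_smul_right] at hodd
  rw [integral_sub (integrable_of_continuous_of_compactSpace (by fun_prop))
    (integrable_of_continuous_of_compactSpace (by fun_prop)),
    integral_const_mul, integral_fvml_inner_self hθ, real_inner_comm] at hodd
  linarith

lemma mul_integral_fvml_inner_sq (hθ : ‖θ‖ = 1) (hθe : ⟪θ, e⟫ = 0) (κ : ℝ) :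
    κ * ∫ x, ⟪x.1, e⟫ ^ 2 ∂fvml k κ θ = ‖e‖ ^ 2 * meanA k κ := by
  rcases eq_or_ne e 0 with rfl | he
  · simp
  have hnorm : ‖e‖ ≠ 0 := norm_ne_zero_iff.2 he
  have hunit : ‖‖e‖⁻¹ • e‖ = 1 := by rw [norm_smul, norm_inv, norm_norm, inv_mul_cancel₀ hnorm]
  have hstein := integral_toSphere_deriv_mul_inner_sq hθ hunit
    (by rw [real_inner_smul_right, hθe, mul_zero])
    (fun t => ((hasDerivAt_id t).const_mul κ).exp) (by fun_prop)
  have hscale (x : Sphere k) : Real.exp (κ * ⟪x.1, θ⟫) * (κ * 1) * ⟪x.1, ‖e‖⁻¹ • e⟫ ^ 2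
      = κ * (‖e‖ ^ 2)⁻¹ * (Real.exp (κ * ⟪x.1, θ⟫) * ⟪x.1, e⟫ ^ 2) := by
    rw [real_inner_smul_right]
    ring
  simp only [id_eq, hscale, integral_const_mul] at hstein
  rw [← integral_fvml_inner_self hθ, integral_fvml, integral_fvml, surfaceMeasure, ← hstein]
  field_simp

/-- The derivative at `τ = 0` in the direction `(s, u)` of the log-likelihood of one observation. -/
def score (κ : ℝ) (θ : EuclideanSpace ℝ (Fin k)) (s : ℝ) (u : EuclideanSpace ℝ (Fin k))
    (x : Sphere k) : ℝ :=
  s * (⟪x.1, θ⟫ - meanA k κ) + κ * ⟪x.1, residual θ u⟫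

/-- The quadratic form of the one-sample Fisher information, with `J_k` eliminated in favour of
`A_k`. -/
def fisherForm (κ : ℝ) (θ : EuclideanSpace ℝ (Fin k)) (s : ℝ) (u : EuclideanSpace ℝ (Fin k)) : ℝ :=
  s ^ 2 * fisherI k κ + κ * meanA k κ * ‖residual θ u‖ ^ 2

lemma integral_score (hθ : ‖θ‖ = 1) (κ s : ℝ) (u : EuclideanSpace ℝ (Fin k)) :
    ∫ x, score κ θ s u x ∂fvml k κ θ = 0 := by
  unfold score
  rw [integral_add (integrable_of_continuous_of_compactSpace (by fun_prop))
    (integrable_of_continuous_of_compactSpace (by fun_prop)), integral_const_mul,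
    integral_const_mul, integral_sub (integrable_of_continuous_of_compactSpace (by fun_prop))
    (integrable_const _), integral_fvml_inner_self hθ, integral_fvml_inner hθ,
    inner_residual_eq_zero hθ]
  simp

lemma integral_score_sq (hθ : ‖θ‖ = 1) (hκ : κ ≠ 0) (s : ℝ) (u : EuclideanSpace ℝ (Fin k)) :
    ∫ x, score κ θ s u x ^ 2 ∂fvml k κ θ = fisherForm κ θ s u := by
  have hθe := inner_residual_eq_zero hθ u
  set e := residual θ u with he
  have hexpand (x : Sphere k) : score κ θ s u x ^ 2
      = s ^ 2 * (⟪x.1, θ⟫ - meanA k κ) ^ 2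
        + 2 * s * κ * ((⟪x.1, θ⟫ - meanA k κ) * ⟪x.1, e⟫) + κ ^ 2 * ⟪x.1, e⟫ ^ 2 := by
    rw [score, ← he]
    ring
  simp only [hexpand]
  rw [integral_add (integrable_of_continuous_of_compactSpace (by fun_prop))
    (integrable_of_continuous_of_compactSpace (by fun_prop)),
    integral_add (integrable_of_continuous_of_compactSpace (by fun_prop))
    (integrable_of_continuous_of_compactSpace (by fun_prop)), integral_const_mul,
    integral_const_mul, integral_const_mul, integral_fvml_inner_sub_meanA_sq hθ hκ,
    integral_fvml_mul_inner_eq_zero hθ hθe κ fun t => t - meanA k κ, fisherForm, ← he]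
  linear_combination κ * mul_integral_fvml_inner_sq hθ hθe κ

lemma fisherForm_nonneg (hθ : ‖θ‖ = 1) (hκ : κ ≠ 0) (s : ℝ) (u : EuclideanSpace ℝ (Fin k)) :
    0 ≤ fisherForm κ θ s u :=
  integral_score_sq hθ hκ s u ▸ integral_nonneg fun _ => sq_nonneg _

lemma log_integral_fvml_exp (hθ : ‖θ‖ = 1) (hθ' : ‖θ'‖ = 1) (κ κ' : ℝ) :
    Real.log (∫ x, Real.exp ⟪x.1, κ' • θ' - κ • θ⟫ ∂fvml k κ θ)
      = logPartition k κ' - logPartition k κ := by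
  have hσ : (surfaceMeasure k).real Set.univ / (projMeasure k).real Set.univ ≠ 0 :=
    (div_pos measureReal_univ_pos measureReal_univ_pos).ne'
  have hexp (x : Sphere k) : Real.exp (κ * ⟪x.1, θ⟫) * Real.exp ⟪x.1, κ' • θ' - κ • θ⟫
      = Real.exp (κ' * ⟪x.1, θ'⟫) := by
    rw [← Real.exp_add, inner_sub_right, real_inner_smul_right, real_inner_smul_right,
      add_sub_cancel]
  rw [integral_fvml]
  simp only [hexp]
  rw [integral_exp_mul_inner_surfaceMeasure hθ, integral_exp_mul_inner_surfaceMeasure hθ',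
    mul_div_mul_left _ _ hσ, ← Real.exp_sub, Real.log_exp]

end OneObservation

section SampleLaw

variable {m k : ℕ} {N : Fin m → ℕ} {v v' : Vec m k}

/-- The log-likelihood ratio of the parameters `(κ', θ')` and `(κ, θ)` for a sample of size `n`. -/
def logRatio {k n : ℕ} (κ : ℝ) (θ : EuclideanSpace ℝ (Fin k)) (κ' : ℝ)
    (θ' : EuclideanSpace ℝ (Fin k)) (y : Fin n → Sphere k) : ℝ :=
  ∑ j, ⟪(y j).1, κ' • θ' - κ • θ⟫ - n * (logPartition k κ' - logPartition k κ)

variable [k.AtLeastTwo]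

lemma sampleLaw_eq_tilted (N : Fin m → ℕ) (v v' : Vec m k) :
    sampleLaw N v' = (sampleLaw N v).tilted fun x =>
      ∑ i, ∑ j, ⟪(x i j).1, conc v' i • loc v' i - conc v i • loc v i⟫ := by
  have hlaw : sampleLaw N v' = Measure.pi fun i => Measure.pi fun _ : Fin (N i) =>
      (fvml k (conc v i) (loc v i)).tilted fun x =>
        ⟪x.1, conc v' i • loc v' i - conc v i • loc v i⟫ := by
    simp only [sampleLaw, ← fvml_eq_tilted]
  rw [hlaw, sampleLaw]
  simp only [pi_tilted]

lemma integral_prod_sampleLaw {𝕜 : Type*} [RCLike 𝕜] (N : Fin m → ℕ) (v : Vec m k)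
    (f : Fin m → Sphere k → 𝕜) :
    ∫ x : Sample m k N, ∏ i, ∏ j, f i (x i j) ∂sampleLaw N v
      = ∏ i, (∫ x, f i x ∂fvml k (conc v i) (loc v i)) ^ N i := by
  rw [sampleLaw, integral_fintype_prod_eq_prod fun i (y : Fin (N i) → Sphere k) => ∏ j, f i (y j)]
  refine Finset.prod_congr rfl fun i _ => ?_
  rw [integral_fintype_prod_eq_prod fun _ : Fin (N i) => f i, Finset.prod_const, Finset.card_univ,
    Fintype.card_fin]

lemma llr_sampleLaw (N : Fin m → ℕ) (hv : v ∈ paramSet m k) (hv' : v' ∈ paramSet m k) :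
    llr (sampleLaw N v') (sampleLaw N v) =ᵐ[sampleLaw N v]
      fun x => ∑ i, logRatio (conc v i) (loc v i) (conc v' i) (loc v' i) (x i) := by
  have hcont : Continuous fun x : Sample m k N =>
      Real.exp (∑ i, ∑ j, ⟪(x i j).1, conc v' i • loc v' i - conc v i • loc v i⟫) := by fun_prop
  have hllr := log_rnDeriv_tilted_left_self
    (integrable_of_continuous_of_compactSpace hcont (μ := sampleLaw N v))
  rw [← sampleLaw_eq_tilted] at hllr
  refine hllr.trans (.of_forall fun x => ?_)
  simp only [logRatio, Finset.sum_sub_distrib, Real.exp_sum]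
  rw [integral_prod_sampleLaw N v
    fun i y => Real.exp ⟪y.1, conc v' i • loc v' i - conc v i • loc v i⟫,
    Real.log_prod fun i _ => pow_ne_zero _ (integral_exp_pos
      (integrable_of_continuous_of_compactSpace (by fun_prop))).ne']
  simp only [Real.log_pow, log_integral_fvml_exp (hv _).2 (hv' _).2]

end SampleLaw

section BlockCoordinates

variable {m k : ℕ} {κ : ℝ} {θ : EuclideanSpace ℝ (Fin k)} {N : Fin m → ℕ} {v : Vec m k}

lemma norm_residual_sq (hθ : ‖θ‖ = 1) (u : EuclideanSpace ℝ (Fin k)) :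
    ‖residual θ u‖ ^ 2 = ‖u‖ ^ 2 - ⟪u, θ⟫ ^ 2 := by
  rw [residual, norm_sub_sq_real, norm_smul, real_inner_smul_right, hθ, mul_one, Real.norm_eq_abs,
    sq_abs]
  ring

lemma rpow_one_sub_inner_sq_smul_signS (hθ : ‖θ‖ = 1) (x : Sphere k) :
    (1 - ⟪x.1, θ⟫ ^ 2) ^ (1 / 2 : ℝ) • signS θ x = residual θ x := by
  have hnorm : 1 - ⟪x.1, θ⟫ ^ 2 = ‖residual θ x‖ ^ 2 := by
    rw [norm_residual_sq hθ, norm_eq_of_mem_sphere, one_pow]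
  rw [hnorm, ← Real.sqrt_eq_rpow, Real.sqrt_sq (norm_nonneg _), signS]
  rcases eq_or_ne (residual θ x) 0 with h | h
  · rw [h, smul_zero, smul_zero]
  · rw [smul_inv_smul₀ (norm_ne_zero_iff.2 h)]

lemma inner_residual_comm (θ x u : EuclideanSpace ℝ (Fin k)) :
    ⟪residual θ x, u⟫ = ⟪x, residual θ u⟫ := by
  simp only [residual, inner_sub_left, inner_sub_right, real_inner_smul_right,
    real_inner_comm]
  ring

lemma inner_centralII {n : ℕ} (hθ : ‖θ‖ = 1) (κ : ℝ) (y : Fin n → Sphere k)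
    (u : EuclideanSpace ℝ (Fin k)) :
    ⟪centralII κ θ y, u⟫ = (n : ℝ) ^ (-1 / 2 : ℝ) * ∑ j, κ * ⟪(y j).1, residual θ u⟫ := by
  simp only [centralII, rpow_one_sub_inner_sq_smul_signS hθ, real_inner_smul_left, sum_inner,
    inner_residual_comm, ← Finset.mul_sum]
  ring

lemma dotProduct_eq_sum_conc_add_inner_loc (v w : Vec m k) :
    v ⬝ᵥ w = ∑ i, (conc v i * conc w i + ⟪loc w i, loc v i⟫) := by
  rw [dotProduct, Fintype.sum_sum_type, Fintype.sum_prod_type_right, ← Finset.sum_add_distrib]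
  simp [conc, loc, PiLp.inner_apply]

lemma dotProduct_central (hv : v ∈ paramSet m k) (τ : Vec m k) (x : Sample m k N) :
    τ ⬝ᵥ central v x = ∑ i, (N i : ℝ) ^ (-1 / 2 : ℝ) *
      ∑ j, score (conc v i) (loc v i) (conc τ i) (loc τ i) (x i j) := by
  have hconc (i : Fin m) : conc (central v x) i = centralI (conc v i) (loc v i) (x i) := rfl
  have hloc (i : Fin m) : loc (central v x) i = centralII (conc v i) (loc v i) (x i) := rfl
  rw [dotProduct_eq_sum_conc_add_inner_loc]
  refine Finset.sum_congr rfl fun i _ => ?_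
  rw [hconc, hloc, inner_centralII (hv i).2, centralI]
  simp only [score, Finset.sum_add_distrib, ← Finset.mul_sum]
  ring

lemma fisherII_mulVec (κ : ℝ) (θ u : EuclideanSpace ℝ (Fin k)) :
    WithLp.toLp 2 (fisherII κ θ *ᵥ u) = (κ ^ 2 * fisherJ k κ / (k - 1)) • residual θ u := by
  have hinner : ⟪u, θ⟫ = θ ⬝ᵥ u := by simp [PiLp.inner_apply, dotProduct]
  rw [residual, hinner, fisherII, smul_mulVec, sub_mulVec, one_mulVec, vecMulVec_mulVec]
  ext a
  simp [-RCLike.inner_apply]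

variable [k.AtLeastTwo]

lemma inner_fisherII_mulVec (hθ : ‖θ‖ = 1) (κ : ℝ) (u : EuclideanSpace ℝ (Fin k)) :
    ⟪WithLp.toLp 2 (fisherII κ θ *ᵥ u), u⟫ = κ * meanA k κ * ‖residual θ u‖ ^ 2 := by
  have hk : (k : ℝ) - 1 ≠ 0 := by linarith [neg_one_lt_sub_three_div_two k]
  have hinner : ⟪residual θ u, u⟫ = ‖residual θ u‖ ^ 2 := by
    rw [norm_residual_sq hθ, residual, inner_sub_left, real_inner_smul_left,
      real_inner_self_eq_norm_sq, real_inner_comm u θ, sq ⟪u, θ⟫]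
  rw [fisherII_mulVec, real_inner_smul_left, hinner, sq, mul_assoc, mul_fisherJ]
  field_simp

lemma dotProduct_fisher (hv : v ∈ paramSet m k) (τ : Vec m k) :
    τ ⬝ᵥ fisher v *ᵥ τ = ∑ i, fisherForm (conc v i) (loc v i) (conc τ i) (loc τ i) := by
  have hconc (i : Fin m) :
      conc (WithLp.toLp 2 (fisher v *ᵥ τ)) i = fisherI k (conc v i) * conc τ i := by
    simp [conc, fisher, mulVec, dotProduct, diagonal_apply]
  have hloc (i : Fin m) : loc (WithLp.toLp 2 (fisher v *ᵥ τ)) i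
      = WithLp.toLp 2 (fisherII (conc v i) (loc v i) *ᵥ loc τ i) := by
    ext a
    simp [loc, fisher, mulVec, dotProduct, blockDiagonal_apply, Fintype.sum_prod_type_right]
  refine (dotProduct_eq_sum_conc_add_inner_loc τ (WithLp.toLp 2 (fisher v *ᵥ τ))).trans ?_
  refine Finset.sum_congr rfl fun i _ => ?_
  rw [hconc, hloc, inner_fisherII_mulVec (hv i).2, fisherForm]
  ring

lemma posSemidef_fisher (hv : v ∈ paramSet m k) : (fisher v).PosSemidef := by
  refine .of_dotProduct_mulVec_nonneg ?_ fun x => ?_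
  · have hII (i : Fin m) : (fisherII (conc v i) (loc v i))ᵀ = fisherII (conc v i) (loc v i) := by
      simp [fisherII, transpose_vecMulVec]
    simp [IsHermitian, fisher, conjTranspose_eq_transpose_of_trivial, fromBlocks_transpose,
      blockDiagonal_transpose, hII]
  · rw [star_trivial, dotProduct_fisher hv (WithLp.toLp 2 x)]
    exact Finset.sum_nonneg fun i _ => fisherForm_nonneg (hv i).2 (hv i).1.ne' _ _

end BlockCoordinates

section Perturb

variable {m k n : ℕ}

lemma rpow_mul_div_rpow_neg_half (hn : n ≠ 0) (M : ℕ) :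
    (n : ℝ) ^ (-1 / 2 : ℝ) * ((M : ℝ) / n) ^ (-1 / 2 : ℝ) = (M : ℝ) ^ (-1 / 2 : ℝ) := by
  rw [← Real.mul_rpow (by positivity) (by positivity), mul_div_cancel₀ _ (by positivity)]

lemma conc_perturb (hn : n ≠ 0) (N : Fin m → ℕ) (v τ : Vec m k) (i : Fin m) :
    conc (perturb n N v τ) i = conc v i + (N i : ℝ) ^ (-1 / 2 : ℝ) * conc τ i := by
  simp [perturb, conc, scaleMatrix, mulVec, dotProduct, diagonal_apply,
    ← mul_assoc, rpow_mul_div_rpow_neg_half hn]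

lemma loc_perturb (hn : n ≠ 0) (N : Fin m → ℕ) (v τ : Vec m k) (i : Fin m) :
    loc (perturb n N v τ) i = loc v i + (N i : ℝ) ^ (-1 / 2 : ℝ) • loc τ i := by
  ext a
  simp [perturb, loc, scaleMatrix, mulVec, dotProduct, blockDiagonal_apply, one_apply,
    Fintype.sum_prod_type_right,
    ← mul_assoc, rpow_mul_div_rpow_neg_half hn]

end Perturb

section Taylor

variable {f g : ℝ → ℝ} {a c : ℝ}

lemma isLittleO_sub_taylor_two (hf : ∀ᶠ x in 𝓝 a, HasDerivAt f (g x) x)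
    (hg : HasStrictDerivAt g c a) :
    (fun p : ℝ × ℝ => f p.2 - f p.1 - g p.1 * (p.2 - p.1) - c * (p.2 - p.1) ^ 2 / 2)
      =o[𝓝 (a, a)] fun p => (p.2 - p.1) ^ 2 := by
  refine isLittleO_iff.2 fun ε hε => ?_
  have hstrict := hg.isLittleO.def hε
  rw [nhds_prod_eq] at hstrict
  obtain ⟨t, ht, hstrict⟩ := eventually_prod_self_iff'.1 hstrict
  obtain ⟨δ, hδ, hball⟩ := Metric.nhds_basis_ball.eventually_iff.1 (hf.and ht)
  have hnhds := prod_mem_nhds (Metric.ball_mem_nhds a hδ) (Metric.ball_mem_nhds a hδ)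
  filter_upwards [hnhds] with ⟨x, y⟩ ⟨hx, hy⟩
  have hseg : segment ℝ x y ⊆ Metric.ball a δ := (convex_ball a δ).segment_subset hx hy
  have hbound : ∀ z ∈ segment ℝ x y, ‖g z - g x - c * (z - x)‖ ≤ ε * |y - x| := fun z hz => by
    have hzx : |z - x| ≤ |y - x| := Set.abs_sub_left_of_mem_uIcc (segment_eq_uIcc x y ▸ hz)
    calc ‖g z - g x - c * (z - x)‖ ≤ ε * |z - x| := by
          simpa [mul_comm c] using hstrict z (hball (hseg hz)).2 x (hball hx).2
      _ ≤ ε * |y - x| := by gcongr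
  have hmvt := (convex_segment x y).norm_image_sub_le_of_norm_hasDerivWithin_le
    (f := fun z => f z - g x * (z - x) - c * (z - x) ^ 2 / 2)
    (f' := fun z => g z - g x - c * (z - x))
    (fun z hz => ((((hball (hseg hz)).1.sub (((hasDerivAt_id z).sub_const x).const_mul (g x))).sub
      ((((hasDerivAt_id z).sub_const x).pow 2).const_mul c |>.div_const 2)).congr_deriv
        (by simp; ring)).hasDerivWithinAt)
    hbound (left_mem_segment ℝ x y) (right_mem_segment ℝ x y)
  calc ‖f y - f x - g x * (y - x) - c * (y - x) ^ 2 / 2‖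
      = ‖f y - g x * (y - x) - c * (y - x) ^ 2 / 2
          - (f x - g x * (x - x) - c * (x - x) ^ 2 / 2)‖ := by congr 1; ring
    _ ≤ ε * |y - x| * ‖y - x‖ := hmvt
    _ = ε * ‖(y - x) ^ 2‖ := by rw [norm_pow, sq, Real.norm_eq_abs, mul_assoc]

end Taylor

section IsLittleOP

variable {Ω Ω' : ℕ → Type*} [∀ n, MeasurableSpace (Ω n)] [∀ n, MeasurableSpace (Ω' n)]
  {P : ∀ n, Measure (Ω n)} {Q : ∀ n, Measure (Ω' n)} {R S : ∀ n, Ω n → ℝ}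

lemma IsLittleOP.congr (hR : IsLittleOP P R) (hRS : ∀ᶠ n in atTop, R n =ᵐ[P n] S n) :
    IsLittleOP P S := by
  refine fun ε hε => (hR ε hε).congr' ?_
  filter_upwards [hRS] with n hn
  refine measure_congr ?_
  filter_upwards [hn] with x hx
  exact congrArg (ε ≤ |·|) hx

lemma IsLittleOP.add (hR : IsLittleOP P R) (hS : IsLittleOP P S) :
    IsLittleOP P fun n x => R n x + S n x := by
  intro ε hε
  have hsum := (hR (ε / 2) (half_pos hε)).add (hS (ε / 2) (half_pos hε))
  rw [add_zero] at hsum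
  refine tendsto_of_tendsto_of_tendsto_of_le_of_le tendsto_const_nhds hsum (fun _ => zero_le)
    fun n => (measure_mono fun x hx => ?_).trans (measure_union_le _ _)
  by_contra! hlt
  simp only [Set.mem_union, Set.mem_ofPred_eq, not_or, not_le] at hlt hx
  linarith [abs_add_le (R n x) (S n x)]

lemma isLittleOP_of_tendsto {d : ℕ → ℝ} (hd : Tendsto d atTop (𝓝 0)) :
    IsLittleOP P fun n _ => d n := by
  refine fun ε hε => tendsto_const_nhds.congr' ?_
  filter_upwards [Metric.tendsto_nhds.1 hd ε hε] with n hn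
  rw [Real.dist_eq, sub_zero] at hn
  simp [not_le.2 hn]

lemma IsLittleOP.sum {ι : Type*} (s : Finset ι) {R : ι → ∀ n, Ω n → ℝ}
    (hR : ∀ i ∈ s, IsLittleOP P (R i)) : IsLittleOP P fun n x => ∑ i ∈ s, R i n x := by
  classical
  induction s using Finset.induction_on with
  | empty => simpa using isLittleOP_of_tendsto (P := P) tendsto_const_nhds
  | insert i s hi ih =>
    simp only [Finset.sum_insert hi]
    exact (hR i (s.mem_insert_self i)).add (ih fun j hj => hR j (Finset.mem_insert_of_mem hj))

lemma IsLittleOP.comp_measurePreserving {R : ∀ n, Ω' n → ℝ} (hR : IsLittleOP Q R)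
    (hRm : ∀ n, AEMeasurable (R n) (Q n)) {T : ∀ n, Ω n → Ω' n}
    (hT : ∀ n, MeasurePreserving (T n) (P n) (Q n)) : IsLittleOP P fun n x => R n (T n x) :=
  fun ε hε => (hR ε hε).congr fun n => ((hT n).measure_preimage
    (nullMeasurableSet_le aemeasurable_const (hRm n).abs)).symm

end IsLittleOP

section WeakLaw

variable {X : Type*} [MeasurableSpace X]

lemma pi_abs_mean_sub_integral_ge_le (ι : Type*) [Fintype ι] [Nonempty ι] {μ : Measure X}
    [IsProbabilityMeasure μ] {g : X → ℝ} (hg : MemLp g 2 μ) {ε : ℝ} (hε : 0 < ε) :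
    Measure.pi (fun _ : ι => μ)
        {y | ε ≤ |(Fintype.card ι : ℝ)⁻¹ * ∑ j, g (y j) - ∫ x, g x ∂μ|}
      ≤ ENNReal.ofReal (Var[g; μ] / (Fintype.card ι * ε ^ 2)) := by
  have hcard : (Fintype.card ι : ℝ) ≠ 0 := by simp
  have heval (j : ι) := measurePreserving_eval (fun _ : ι => μ) j
  have hgj (j : ι) : MemLp (fun y : ι → X => g (y j)) 2 (Measure.pi fun _ => μ) :=
    hg.comp_measurePreserving (heval j)
  have hmean : ∫ y : ι → X, (Fintype.card ι : ℝ)⁻¹ * ∑ j, g (y j) ∂Measure.pi (fun _ => μ)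
      = ∫ x, g x ∂μ := by
    rw [integral_const_mul, integral_finsetSum _ fun j _ => (hgj j).integrable one_le_two]
    simp only [integral_comp_eval (μ := fun _ : ι => μ) hg.aestronglyMeasurable,
      Finset.sum_const, Finset.card_univ, nsmul_eq_mul]
    rw [inv_mul_cancel_left₀ hcard]
  have hvar : Var[fun y : ι → X => (Fintype.card ι : ℝ)⁻¹ * ∑ j, g (y j); Measure.pi fun _ => μ]
      = Var[g; μ] / Fintype.card ι := by
    have hsum := variance_sum_pi (μ := fun _ : ι => μ) (X := fun _ => g) fun _ => hg
    simp only [Finset.sum_const, Finset.card_univ, nsmul_eq_mul] at hsum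
    rw [variance_const_mul, ← Finset.sum_fn, hsum]
    field_simp
  have hcheb := meas_ge_le_variance_div_sq
    ((memLp_finsetSum Finset.univ fun j _ => hgj j).const_mul (Fintype.card ι : ℝ)⁻¹) hε
  rwa [hmean, hvar, div_div] at hcheb

lemma isLittleOP_mean_sub_integral {μ : ℕ → Measure X} [∀ n, IsProbabilityMeasure (μ n)]
    {M : ℕ → ℕ} (hM : Tendsto M atTop atTop) {g : ℕ → X → ℝ} (hg : ∀ n, AEMeasurable (g n) (μ n))
    {C : ℝ} (hC : ∀ᶠ n in atTop, ∀ x, |g n x| ≤ C) :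
    IsLittleOP (fun n => Measure.pi fun _ : Fin (M n) => μ n)
      fun n y => (M n : ℝ)⁻¹ * ∑ j, g n (y j) - ∫ x, g n x ∂μ n := by
  intro ε hε
  have hlim : Tendsto (fun n => ENNReal.ofReal (C ^ 2 / (M n * ε ^ 2))) atTop (𝓝 0) := by
    rw [← ENNReal.ofReal_zero]
    exact ENNReal.tendsto_ofReal (tendsto_const_nhds.div_atTop
      ((tendsto_natCast_atTop_atTop.comp hM).atTop_mul_const (by positivity)))
  refine tendsto_of_tendsto_of_tendsto_of_le_of_le' tendsto_const_nhds hlim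
    (.of_forall fun _ => zero_le) ?_
  filter_upwards [hC, hM.eventually_ge_atTop 1] with n hbound hn
  have : Nonempty (Fin (M n)) := ⟨⟨0, hn⟩⟩
  have hcheb := pi_abs_mean_sub_integral_ge_le (Fin (M n))
    (MemLp.of_bound (p := 2) (hg n).aestronglyMeasurable C (.of_forall hbound)) hε
  rw [Fintype.card_fin] at hcheb
  have hvar : Var[g n; μ n] ≤ C ^ 2 :=
    (variance_le_sq_of_bounded (.of_forall fun x => abs_le.1 (hbound x)) (hg n)).trans_eq (by ring)
  exact hcheb.trans (by gcongr)

end WeakLaw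

section LogLikelihoodRemainder

variable {k : ℕ} {κ a s : ℝ} {θ u : EuclideanSpace ℝ (Fin k)}

lemma inner_eq_of_norm_add_smul (ha : a ≠ 0) (hθ : ‖θ‖ = 1) (hθ' : ‖θ + a • u‖ = 1) :
    ⟪θ, u⟫ = -(a * ‖u‖ ^ 2 / 2) := by
  have h := norm_add_sq_real θ (a • u)
  rw [hθ, hθ', norm_smul, mul_pow, Real.norm_eq_abs, sq_abs, real_inner_smul_right] at h
  refine mul_left_cancel₀ ha ?_
  linear_combination -h / 2

/-- The direction `w` of the second-order term in the expansion of `(κ + a s) (θ + a u) - κ θ`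
along the sphere: the linear term is the direction of the score and the quadratic one is
`a ^ 2 • w`. -/
def secondOrderDirection (κ : ℝ) (θ : EuclideanSpace ℝ (Fin k)) (s : ℝ)
    (u : EuclideanSpace ℝ (Fin k)) : EuclideanSpace ℝ (Fin k) :=
  s • u - (κ * ‖u‖ ^ 2 / 2) • θ

lemma add_mul_smul_add_smul_sub (ha : a ≠ 0) (hθ : ‖θ‖ = 1) (hθ' : ‖θ + a • u‖ = 1) :
    (κ + a * s) • (θ + a • u) - κ • θ
      = a • (s • θ + κ • residual θ u) + a ^ 2 • secondOrderDirection κ θ s u := by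
  rw [residual, real_inner_comm, inner_eq_of_norm_add_smul ha hθ hθ', secondOrderDirection]
  module

/-- The remainder of the second-order Taylor expansion of `logPartition k` at `κ`. -/
def logPartitionRemainder (k : ℕ) (κ h : ℝ) : ℝ :=
  logPartition k (κ + h) - logPartition k κ - meanA k κ * h - fisherI k κ * h ^ 2 / 2

lemma norm_secondOrderDirection_le (hθ : ‖θ‖ = 1) (κ s : ℝ) (u : EuclideanSpace ℝ (Fin k)) :
    ‖secondOrderDirection κ θ s u‖ ≤ |s| * ‖u‖ + |κ| * ‖u‖ ^ 2 / 2 := by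
  refine (norm_sub_le _ _).trans_eq ?_
  simp [norm_smul, hθ]

variable [k.AtLeastTwo]

lemma logRatio_eq {n : ℕ} (hna : n * a ^ 2 = 1) (hθ : ‖θ‖ = 1) (hθ' : ‖θ + a • u‖ = 1)
    (y : Fin n → Sphere k) :
    logRatio κ θ (κ + a * s) (θ + a • u) y
      = a * ∑ j, score κ θ s u (y j) - fisherForm κ θ s u / 2
        + ((n : ℝ)⁻¹ * ∑ j, ⟪(y j).1, secondOrderDirection κ θ s u⟫
          - ∫ x, ⟪x.1, secondOrderDirection κ θ s u⟫ ∂fvml k κ θ)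
        + (meanA k κ * (s * ⟪θ, u⟫ - κ * ⟪θ, u⟫ ^ 2 / 2)
          - n * logPartitionRemainder k κ (a * s)) := by
  have ha : a ≠ 0 := by rintro rfl; simp at hna
  have hinv : (n : ℝ)⁻¹ = a ^ 2 := inv_eq_of_mul_eq_one_right hna
  have hinner (j : Fin n) : ⟪(y j).1, (κ + a * s) • (θ + a • u) - κ • θ⟫
      = a * score κ θ s u (y j) + a * s * meanA k κ
        + a ^ 2 * ⟪(y j).1, secondOrderDirection κ θ s u⟫ := by
    rw [add_mul_smul_add_smul_sub ha hθ hθ', score]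
    simp only [inner_add_right, real_inner_smul_right]
    ring
  have hw : ⟪θ, secondOrderDirection κ θ s u⟫ = s * ⟪θ, u⟫ - κ * ‖u‖ ^ 2 / 2 := by
    rw [secondOrderDirection, inner_sub_right, real_inner_smul_right, real_inner_smul_right,
      real_inner_self_eq_norm_sq, hθ]
    ring
  simp only [logRatio, hinner, Finset.sum_add_distrib, ← Finset.mul_sum, Finset.sum_const,
    Finset.card_univ, Fintype.card_fin, nsmul_eq_mul]
  rw [integral_fvml_inner hθ, hw, hinv, fisherForm, norm_residual_sq hθ, real_inner_comm,
    logPartitionRemainder]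
  linear_combination -(s ^ 2 * fisherI k κ / 2) * hna

lemma continuousAt_meanA (hκ : κ ≠ 0) : ContinuousAt (meanA k) κ :=
  (hasStrictDerivAt_meanA hκ).hasDerivAt.continuousAt

lemma continuousAt_fisherI (hκ : κ ≠ 0) : ContinuousAt (fisherI k) κ :=
  (continuousAt_const.sub ((continuousAt_const.div continuousAt_id hκ).mul
    (continuousAt_meanA hκ))).sub ((continuousAt_meanA hκ).pow 2)

lemma isLittleO_logPartitionRemainder (hκ : κ ≠ 0) :
    (fun p : ℝ × ℝ => logPartitionRemainder k p.1 p.2) =o[𝓝 (κ, 0)] fun p => p.2 ^ 2 := by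
  have hshift : Tendsto (fun p : ℝ × ℝ => (p.1, p.1 + p.2)) (𝓝 (κ, 0)) (𝓝 (κ, κ)) := by
    have : Continuous fun p : ℝ × ℝ => (p.1, p.1 + p.2) := by fun_prop
    simpa using this.tendsto (κ, 0)
  have htaylor := (isLittleO_sub_taylor_two (.of_forall hasDerivAt_logPartition)
    (hasStrictDerivAt_meanA (k := k) hκ)).comp_tendsto hshift
  have hfisher : (fun p : ℝ × ℝ => (fisherI k κ - fisherI k p.1) / 2) =o[𝓝 (κ, 0)]
      fun _ => (1 : ℝ) := by
    rw [isLittleO_one_iff]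
    have hlim := ((continuousAt_fisherI (k := k) hκ).tendsto.const_sub (fisherI k κ)).div_const 2
    rw [sub_self, zero_div] at hlim
    exact hlim.comp (continuous_fst.tendsto (κ, (0 : ℝ)))
  refine (htaylor.add (hfisher.mul_isBigO (isBigO_refl (fun p : ℝ × ℝ => p.2 ^ 2) _)
    |>.congr_right fun p => by simp)).congr (fun p => ?_) fun p => ?_
  · simp only [Function.comp_apply, logPartitionRemainder]
    ring
  · simp

lemma continuousOn_fisherForm :
    ContinuousOn (fun p : (ℝ × EuclideanSpace ℝ (Fin k)) × (ℝ × EuclideanSpace ℝ (Fin k)) =>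
      fisherForm p.1.1 p.1.2 p.2.1 p.2.2) ({p | p.1 ≠ 0} ×ˢ Set.univ) := by
  intro p hp
  have hfst : Tendsto (fun q : (ℝ × EuclideanSpace ℝ (Fin k)) × (ℝ × EuclideanSpace ℝ (Fin k)) =>
    q.1.1) (𝓝 p) (𝓝 p.1.1) := (continuous_fst.comp continuous_fst).tendsto p
  have hA := (continuousAt_meanA (k := k) hp.1).tendsto.comp hfst
  have hI := (continuousAt_fisherI (k := k) hp.1).tendsto.comp hfst
  have hres : Continuous fun q : (ℝ × EuclideanSpace ℝ (Fin k)) × (ℝ × EuclideanSpace ℝ (Fin k)) =>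
      residual q.1.2 q.2.2 := by unfold residual; fun_prop
  have hs : Continuous fun q : (ℝ × EuclideanSpace ℝ (Fin k)) × (ℝ × EuclideanSpace ℝ (Fin k)) =>
      q.2.1 := by fun_prop
  exact (((hs.tendsto p).pow 2).mul hI |>.add
    ((hfst.mul hA).mul ((hres.tendsto p).norm.pow 2))).mono_left nhdsWithin_le_nhds

end LogLikelihoodRemainder

section OneSampleExpansion

variable {k : ℕ} {κ C : ℝ} {θ : EuclideanSpace ℝ (Fin k)} {κn a s : ℕ → ℝ} {M : ℕ → ℕ}
  {θn u : ℕ → EuclideanSpace ℝ (Fin k)}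

lemma tendsto_inner_of_norm_add_smul (ha : Tendsto a atTop (𝓝 0)) (ha0 : ∀ᶠ n in atTop, a n ≠ 0)
    (hu : ∀ n, ‖u n‖ ≤ C) (hθn : ∀ n, ‖θn n‖ = 1)
    (hθn' : ∀ᶠ n in atTop, ‖θn n + a n • u n‖ = 1) :
    Tendsto (fun n => ⟪θn n, u n⟫) atTop (𝓝 0) := by
  have hlim : Tendsto (fun n => ‖u n‖ ^ 2 * (-a n / 2)) atTop (𝓝 0) :=
    bdd_le_mul_tendsto_zero' (C ^ 2) (.of_forall fun n => by
      rw [abs_of_nonneg (by positivity)]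
      exact pow_le_pow_left₀ (norm_nonneg _) (hu n) 2) (by simpa using ha.neg.div_const 2)
  refine hlim.congr' ?_
  filter_upwards [ha0, hθn'] with n hn hn'
  rw [inner_eq_of_norm_add_smul hn (hθn n) hn']
  ring

variable [k.AtLeastTwo]

lemma tendsto_mul_logPartitionRemainder (hκ : κ ≠ 0) (hκn : Tendsto κn atTop (𝓝 κ))
    (ha : Tendsto a atTop (𝓝 0)) (hMa : ∀ᶠ n in atTop, M n * a n ^ 2 = 1) (hs : ∀ n, |s n| ≤ C) :
    Tendsto (fun n => M n * logPartitionRemainder k (κn n) (a n * s n)) atTop (𝓝 0) := by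
  have has : Tendsto (fun n => a n * s n) atTop (𝓝 0) := by
    simpa only [mul_comm] using bdd_le_mul_tendsto_zero' C (.of_forall hs) ha
  have hrem : (fun n => logPartitionRemainder k (κn n) (a n * s n)) =o[atTop] fun n => a n ^ 2 := by
    refine ((isLittleO_logPartitionRemainder hκ).comp_tendsto
      (hκn.prodMk_nhds has)).trans_isBigO (.of_bound (C ^ 2) (.of_forall fun n => ?_))
    simp only [Function.comp_apply, mul_pow, norm_mul, norm_pow, Real.norm_eq_abs, mul_comm (C ^ 2)]
    gcongr
    exact hs n
  rw [← isLittleO_one_iff ℝ]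
  exact ((isBigO_refl (fun n => (M n : ℝ)) atTop).mul_isLittleO hrem).congr' .rfl hMa

lemma tendsto_fisherForm_sub (hκ : κ ≠ 0) (hκn : Tendsto κn atTop (𝓝 κ))
    (hθn : Tendsto θn atTop (𝓝 θ)) (hs : ∀ n, |s n| ≤ C) (hu : ∀ n, ‖u n‖ ≤ C) :
    Tendsto (fun n => fisherForm (κn n) (θn n) (s n) (u n) - fisherForm κ θ (s n) (u n)) atTop
      (𝓝 0) := by
  rw [Metric.tendsto_nhds]
  intro ε hε
  obtain ⟨V, hV, hclose⟩ := (isCompact_closedBall (0 : ℝ × EuclideanSpace ℝ (Fin k))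
    C).mem_uniformity_of_prod (f := fun p q => fisherForm p.1 p.2 q.1 q.2) (q := (κ, θ))
      (continuousOn_fisherForm.mono (Set.prod_mono_right (Set.subset_univ _))) hκ
      (Metric.dist_mem_uniformity hε)
  have hopen : IsOpen {p : ℝ × EuclideanSpace ℝ (Fin k) | p.1 ≠ 0} :=
    isOpen_ne.preimage continuous_fst
  rw [hopen.nhdsWithin_eq hκ] at hV
  filter_upwards [(hκn.prodMk_nhds hθn).eventually hV] with n hn
  have := hclose (κn n, θn n) hn (s n, u n) (by simpa using ⟨hs n, hu n⟩)
  rwa [Set.mem_ofPred_eq, Real.dist_eq, ← sub_zero (_ - _), ← Real.dist_eq] at this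

lemma isLittleOP_mean_inner_secondOrderDirection (hκn : Tendsto κn atTop (𝓝 κ))
    (hθn1 : ∀ n, ‖θn n‖ = 1) (hM : Tendsto M atTop atTop) (hs : ∀ n, |s n| ≤ C)
    (hu : ∀ n, ‖u n‖ ≤ C) :
    IsLittleOP (fun n => Measure.pi fun _ : Fin (M n) => fvml k (κn n) (θn n)) fun n y =>
      (M n : ℝ)⁻¹ * ∑ j, ⟪(y j).1, secondOrderDirection (κn n) (θn n) (s n) (u n)⟫
        - ∫ x, ⟪x.1, secondOrderDirection (κn n) (θn n) (s n) (u n)⟫ ∂fvml k (κn n) (θn n) := by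
  have hC : 0 ≤ C := (abs_nonneg _).trans (hs 0)
  have hbound : ∀ᶠ n in atTop, ∀ x : Sphere k,
      |⟪x.1, secondOrderDirection (κn n) (θn n) (s n) (u n)⟫| ≤ C * C + (|κ| + 1) * C ^ 2 / 2 := by
    filter_upwards [hκn.abs.eventually_le_const (lt_add_one |κ|)] with n hn x
    calc |⟪x.1, secondOrderDirection (κn n) (θn n) (s n) (u n)⟫|
        ≤ |s n| * ‖u n‖ + |κn n| * ‖u n‖ ^ 2 / 2 :=
          (abs_inner_sphere_le x _).trans (norm_secondOrderDirection_le (hθn1 n) _ _ _)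
      _ ≤ C * C + (|κ| + 1) * C ^ 2 / 2 := by gcongr <;> apply_assumption
  exact isLittleOP_mean_sub_integral (μ := fun n => fvml k (κn n) (θn n))
    (g := fun n x => ⟪x.1, secondOrderDirection (κn n) (θn n) (s n) (u n)⟫) hM
    (fun n => Continuous.aemeasurable (by fun_prop)) hbound

lemma isLittleOP_logRatio (hκ : κ ≠ 0) (hκn : Tendsto κn atTop (𝓝 κ))
    (hθn : Tendsto θn atTop (𝓝 θ)) (hθn1 : ∀ n, ‖θn n‖ = 1) (hM : Tendsto M atTop atTop)
    (ha : Tendsto a atTop (𝓝 0)) (hMa : ∀ᶠ n in atTop, M n * a n ^ 2 = 1)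
    (hs : ∀ n, |s n| ≤ C) (hu : ∀ n, ‖u n‖ ≤ C) (hθn' : ∀ᶠ n in atTop, ‖θn n + a n • u n‖ = 1) :
    IsLittleOP (fun n => Measure.pi fun _ : Fin (M n) => fvml k (κn n) (θn n)) fun n y =>
      logRatio (κn n) (θn n) (κn n + a n * s n) (θn n + a n • u n) y
        - (a n * ∑ j, score (κn n) (θn n) (s n) (u n) (y j)
          - fisherForm κ θ (s n) (u n) / 2) := by
  have ha0 : ∀ᶠ n in atTop, a n ≠ 0 := hMa.mono fun n hn h => by simp [h] at hn
  have hinner := tendsto_inner_of_norm_add_smul ha ha0 hu hθn1 hθn'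
  have hA : Tendsto (fun n => meanA k (κn n)) atTop (𝓝 (meanA k κ)) :=
    (continuousAt_meanA hκ).tendsto.comp hκn
  have hlim : Tendsto (fun n => meanA k (κn n)
      * (s n * ⟪θn n, u n⟫ - κn n * ⟪θn n, u n⟫ ^ 2 / 2)
      - M n * logPartitionRemainder k (κn n) (a n * s n)
      - (fisherForm (κn n) (θn n) (s n) (u n) - fisherForm κ θ (s n) (u n)) / 2) atTop (𝓝 0) := by
    simpa using ((hA.mul ((bdd_le_mul_tendsto_zero' C (.of_forall hs) hinner).sub
      ((hκn.mul (hinner.pow 2)).div_const 2))).sub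
      (tendsto_mul_logPartitionRemainder hκ hκn ha hMa hs)).sub
      ((tendsto_fisherForm_sub hκ hκn hθn hs hu).div_const 2)
  refine ((isLittleOP_mean_inner_secondOrderDirection hκn hθn1 hM hs hu).add
    (isLittleOP_of_tendsto hlim)).congr ?_
  filter_upwards [hMa, hθn'] with n hna hn'
  refine .of_forall fun y => ?_
  simp only [logRatio_eq hna (hθn1 n) hn']
  ring

end OneSampleExpansion

section BoundedCentralLimit

lemma tendsto_one_add_pow_exp_of_tendsto_mul {M : ℕ → ℕ} {g : ℕ → ℂ} {t : ℂ}
    (hM : Tendsto M atTop atTop) (hg : Tendsto (fun n => M n * g n) atTop (𝓝 t)) :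
    Tendsto (fun n => (1 + g n) ^ M n) atTop (𝓝 (Complex.exp t)) := by
  have hg0 : Tendsto g atTop (𝓝 0) := by
    have hinv : Tendsto (fun n => (M n : ℂ)⁻¹) atTop (𝓝 0) :=
      tendsto_inv_atTop_nhds_zero_nat.comp hM
    rw [← zero_mul t]
    refine (hinv.mul hg).congr' ?_
    filter_upwards [hM.eventually_ne_atTop 0] with n hn
    rw [inv_mul_cancel_left₀ (Nat.cast_ne_zero.2 hn)]
  have hlog : (fun n => M n * (Complex.log (1 + g n) - g n)) =o[atTop] fun _ => (1 : ℂ) := by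
    have hderiv := (Complex.log_sub_self_isBigO.trans_isLittleO
      (isLittleO_pow_id one_lt_two)).comp_tendsto hg0
    exact ((isBigO_refl _ _).mul_isLittleO hderiv).trans_isBigO (hg.isBigO_one ℂ)
  have hsum := (isLittleO_one_iff ℂ |>.1 hlog).add hg
  rw [zero_add] at hsum
  refine hsum.cexp.congr' ?_
  have hne : ∀ᶠ n in atTop, 1 + g n ≠ 0 := by
    have := hg0.const_add 1
    rw [add_zero] at this
    exact this.eventually_ne one_ne_zero
  filter_upwards [hne] with n hn
  rw [← mul_add, sub_add_cancel, Complex.exp_nat_mul, Complex.exp_log hn]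

lemma norm_exp_mul_I_sub_taylor_two_le {x : ℝ} (hx : |x| ≤ 1) :
    ‖Complex.exp (x * Complex.I) - (1 + x * Complex.I - x ^ 2 / 2)‖ ≤ |x| ^ 3 := by
  have hnorm : ‖(x : ℂ) * Complex.I‖ = |x| := by simp
  have hsum : ∑ j ∈ Finset.range 3, ((x : ℂ) * Complex.I) ^ j / (j.factorial : ℂ)
      = 1 + x * Complex.I - x ^ 2 / 2 := by
    simp [Finset.sum_range_succ, mul_pow, Nat.factorial]
    ring
  have hexp := Complex.exp_bound (hnorm.trans_le hx) (n := 3) three_pos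
  rw [hsum, hnorm] at hexp
  exact hexp.trans (mul_le_of_le_one_right (by positivity) (by norm_num [Nat.factorial]))

variable {X : Type*} [MeasurableSpace X]

lemma norm_integral_exp_mul_I_sub_le {μ : Measure X} [IsProbabilityMeasure μ] {g : X → ℝ}
    (hg : AEMeasurable g μ) {C : ℝ} (hC : ∀ x, |g x| ≤ C) (hC1 : C ≤ 1) :
    ‖∫ x, Complex.exp (g x * Complex.I) ∂μ
        - (1 + (∫ x, g x ∂μ : ℝ) * Complex.I - (∫ x, g x ^ 2 ∂μ : ℝ) / 2)‖ ≤ C ^ 3 := by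
  have hgi : Integrable g μ := .of_bound hg.aestronglyMeasurable C (.of_forall hC)
  have hg2 : Integrable (fun x => g x ^ 2) μ :=
    .of_bound (hg.pow_const 2).aestronglyMeasurable (C ^ 2) (.of_forall fun x => by
      rw [norm_pow]
      exact pow_le_pow_left₀ (abs_nonneg _) (hC x) 2)
  have hlin : Integrable (fun x => 1 + (g x : ℂ) * Complex.I) μ :=
    (integrable_const _).add (hgi.ofReal.mul_const _)
  have hsq : Integrable (fun x => (g x : ℂ) ^ 2 / 2) μ := by
    simpa using hg2.ofReal (𝕜 := ℂ) |>.div_const 2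
  have hexp : Integrable (fun x => Complex.exp (g x * Complex.I)) μ :=
    .of_bound (by fun_prop) 1 (.of_forall fun x => (Complex.norm_exp_ofReal_mul_I _).le)
  have hint : ∫ x, (1 + (g x : ℂ) * Complex.I - (g x : ℂ) ^ 2 / 2) ∂μ
      = 1 + (∫ x, g x ∂μ : ℝ) * Complex.I - (∫ x, g x ^ 2 ∂μ : ℝ) / 2 := by
    rw [integral_sub hlin hsq, integral_add (integrable_const _) (hgi.ofReal.mul_const _),
      integral_mul_const, integral_div, ← integral_complex_ofReal, ← integral_complex_ofReal]
    simp
  rw [← hint, ← integral_sub hexp (g := fun x => 1 + (g x : ℂ) * Complex.I - (g x : ℂ) ^ 2 / 2)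
    (hlin.sub hsq)]
  refine (norm_integral_le_of_norm_le_const (.of_forall fun x =>
    (norm_exp_mul_I_sub_taylor_two_le ((hC x).trans hC1)).trans
      (pow_le_pow_left₀ (abs_nonneg _) (hC x) 3))).trans_eq ?_
  simp

lemma norm_mul_integral_exp_mul_I_sub_one_add_le {μ : Measure X} [IsProbabilityMeasure μ]
    {g : X → ℝ} (hg : AEMeasurable g μ) {C : ℝ} (hC : ∀ x, |g x| ≤ C) (hg0 : ∫ x, g x ∂μ = 0)
    {n : ℕ} {a : ℝ} (haC : |a| * C ≤ 1) (hna : n * a ^ 2 = 1) :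
    ‖n * (∫ x, Complex.exp ((a * g x : ℝ) * Complex.I) ∂μ - 1) + ((∫ x, g x ^ 2 ∂μ) / 2 : ℝ)‖
      ≤ |a| * C ^ 3 := by
  have hstep := norm_integral_exp_mul_I_sub_le (hg.const_mul a)
    (fun x => (abs_mul a (g x)).trans_le (mul_le_mul_of_nonneg_left (hC x) (abs_nonneg _))) haC
  simp only [mul_pow a, integral_const_mul, hg0] at hstep
  set φ := ∫ x, Complex.exp ((a * g x : ℝ) * Complex.I) ∂μ
  set V := ∫ x, g x ^ 2 ∂μ
  have hna' : (n : ℂ) * (a : ℂ) ^ 2 = 1 := by exact_mod_cast hna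
  calc ‖n * (φ - 1) + (V / 2 : ℝ)‖
      = ‖(n : ℂ) * (φ - (1 + (a * 0 : ℝ) * Complex.I - (a ^ 2 * V : ℝ) / 2))‖ := by
        congr 1
        push_cast
        linear_combination -(V / 2 : ℂ) * hna'
    _ ≤ n * (|a| * C) ^ 3 := by
        rw [norm_mul, Complex.norm_natCast]
        exact mul_le_mul_of_nonneg_left hstep n.cast_nonneg
    _ = |a| * C ^ 3 := by linear_combination |a| * C ^ 3 * hna + n * |a| * C ^ 3 * sq_abs a

lemma tendsto_integral_exp_mul_I_pow {μ : ℕ → Measure X} [∀ n, IsProbabilityMeasure (μ n)]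
    {g : ℕ → X → ℝ} (hg : ∀ n, AEMeasurable (g n) (μ n)) {C : ℝ}
    (hC : ∀ᶠ n in atTop, ∀ x, |g n x| ≤ C) (hg0 : ∀ n, ∫ x, g n x ∂μ n = 0) {V : ℝ}
    (hV : Tendsto (fun n => ∫ x, g n x ^ 2 ∂μ n) atTop (𝓝 V)) {M : ℕ → ℕ} {a : ℕ → ℝ}
    (hM : Tendsto M atTop atTop) (ha : Tendsto a atTop (𝓝 0))
    (hMa : ∀ᶠ n in atTop, M n * a n ^ 2 = 1) :
    Tendsto (fun n => (∫ x, Complex.exp ((a n * g n x : ℝ) * Complex.I) ∂μ n) ^ M n) atTop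
      (𝓝 (Complex.exp (-(V / 2 : ℝ)))) := by
  have hrem : Tendsto (fun n => M n * (∫ x, Complex.exp ((a n * g n x : ℝ) * Complex.I) ∂μ n - 1)
      + ((∫ x, g n x ^ 2 ∂μ n) / 2 : ℝ)) atTop (𝓝 0) := by
    have hlim (c : ℝ) : Tendsto (fun n => |a n| * c) atTop (𝓝 0) := by
      simpa using ha.abs.mul_const c
    refine squeeze_zero_norm' ?_ (hlim (C ^ 3))
    filter_upwards [hC, hMa, (hlim C).eventually_le_const one_pos] with n hCn hna haC
    exact norm_mul_integral_exp_mul_I_sub_one_add_le (hg n) hCn (hg0 n) haC hna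
  have hmul := hrem.sub ((Complex.continuous_ofReal.tendsto _).comp (hV.div_const 2))
  simp only [Function.comp_apply, add_sub_cancel_right, zero_sub] at hmul
  simpa only [add_sub_cancel] using tendsto_one_add_pow_exp_of_tendsto_mul hM hmul

end BoundedCentralLimit

section CentralSequence

variable {m k : ℕ} {κ : ℝ} {θ : EuclideanSpace ℝ (Fin k)} {N : ℕ → Fin m → ℕ} {v : Vec m k}
  {vn : ℕ → Vec m k}

lemma continuous_conc (i : Fin m) : Continuous fun v : Vec m k => conc v i := by
  unfold conc
  fun_prop

lemma continuous_loc (i : Fin m) : Continuous fun v : Vec m k => loc v i := by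
  unfold loc
  fun_prop

lemma continuous_central {N : Fin m → ℕ} (hv : v ∈ paramSet m k) :
    Continuous (central v : Sample m k N → Vec m k) := by
  refine (PiLp.continuous_toLp 2 _).comp (continuous_pi ?_)
  rintro (i | ⟨a, i⟩)
  · simp only [Sum.elim_inl, centralI]
    fun_prop
  · simp only [Sum.elim_inr, centralII, rpow_one_sub_inner_sq_smul_signS (hv i).2, residual]
    fun_prop

lemma tendsto_rpow_neg_half {M : ℕ → ℕ} (hM : Tendsto M atTop atTop) :
    Tendsto (fun n => (M n : ℝ) ^ (-1 / 2 : ℝ)) atTop (𝓝 0) := by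
  rw [neg_div]
  exact (tendsto_rpow_neg_atTop one_half_pos).comp (tendsto_natCast_atTop_atTop.comp hM)

lemma mul_rpow_neg_half_sq {x : ℝ} (hx : 0 < x) : x * (x ^ (-1 / 2 : ℝ)) ^ 2 = 1 := by
  rw [← Real.rpow_mul_natCast hx.le, show (-1 / 2 : ℝ) * (2 : ℕ) = -1 by norm_num,
    Real.rpow_neg_one, mul_inv_cancel₀ hx.ne']

lemma eventually_mul_rpow_neg_half_sq {M : ℕ → ℕ} (hM : Tendsto M atTop atTop) :
    ∀ᶠ n in atTop, M n * ((M n : ℝ) ^ (-1 / 2 : ℝ)) ^ 2 = 1 := by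
  filter_upwards [hM.eventually_gt_atTop 0] with n hn
  exact mul_rpow_neg_half_sq (Nat.cast_pos.2 hn)

lemma tendsto_atTop_of_tendsto_div {M : ℕ → ℕ} {r : ℝ} (hr : 0 < r)
    (hM : Tendsto (fun n => (M n : ℝ) / n) atTop (𝓝 r)) : Tendsto M atTop atTop := by
  rw [← tendsto_natCast_atTop_iff (R := ℝ)]
  refine (hM.pos_mul_atTop hr tendsto_natCast_atTop_atTop).congr' ?_
  filter_upwards [eventually_ne_atTop 0] with n hn
  field_simp

lemma tendsto_of_sub_isBigO_rpow_neg_half {E : Type*} [NormedAddCommGroup E] {e : E} {f : ℕ → E}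
    (h : (fun n => f n - e) =O[atTop] fun n : ℕ => (n : ℝ) ^ (-1 / 2 : ℝ)) :
    Tendsto f atTop (𝓝 e) :=
  tendsto_sub_nhds_zero_iff.1 (h.trans_tendsto (tendsto_rpow_neg_half tendsto_id))

lemma norm_residual_le (hθ : ‖θ‖ = 1) (u : EuclideanSpace ℝ (Fin k)) : ‖residual θ u‖ ≤ ‖u‖ := by
  refine (sq_le_sq₀ (norm_nonneg _) (norm_nonneg _)).1 ?_
  rw [norm_residual_sq hθ]
  exact sub_le_self _ (sq_nonneg _)

lemma abs_score_le (hθ : ‖θ‖ = 1) (κ s : ℝ) (u : EuclideanSpace ℝ (Fin k)) (x : Sphere k) :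
    |score κ θ s u x| ≤ |s| * (1 + |meanA k κ|) + |κ| * ‖u‖ := by
  have hx : |⟪x.1, θ⟫ - meanA k κ| ≤ 1 + |meanA k κ| :=
    (abs_sub _ _).trans (add_le_add_left ((abs_inner_sphere_le x θ).trans_eq hθ) _)
  have hres : |⟪x.1, residual θ u⟫| ≤ ‖u‖ :=
    (abs_inner_sphere_le x _).trans (norm_residual_le hθ u)
  refine (abs_add_le _ _).trans ?_
  rw [abs_mul, abs_mul]
  gcongr

variable [k.AtLeastTwo]

lemma tendsto_integral_exp_score_pow {κn a : ℕ → ℝ} {M : ℕ → ℕ}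
    {θn : ℕ → EuclideanSpace ℝ (Fin k)} (hκ : κ ≠ 0) (hκn : Tendsto κn atTop (𝓝 κ))
    (hθn : Tendsto θn atTop (𝓝 θ)) (hθn1 : ∀ n, ‖θn n‖ = 1) (hM : Tendsto M atTop atTop)
    (ha : Tendsto a atTop (𝓝 0)) (hMa : ∀ᶠ n in atTop, M n * a n ^ 2 = 1) (s : ℝ)
    (u : EuclideanSpace ℝ (Fin k)) :
    Tendsto (fun n => (∫ x, Complex.exp ((a n * score (κn n) (θn n) s u x : ℝ) * Complex.I)
        ∂fvml k (κn n) (θn n)) ^ M n) atTop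
      (𝓝 (Complex.exp (-(fisherForm κ θ s u / 2 : ℝ)))) := by
  have hB : Tendsto (fun n => |s| * (1 + |meanA k (κn n)|) + |κn n| * ‖u‖) atTop
      (𝓝 (|s| * (1 + |meanA k κ|) + |κ| * ‖u‖)) :=
    ((((continuousAt_meanA hκ).tendsto.comp hκn).abs.const_add 1).const_mul _).add
      (hκn.abs.mul_const _)
  have hV : Tendsto (fun n => fisherForm (κn n) (θn n) s u) atTop (𝓝 (fisherForm κ θ s u)) :=
    tendsto_sub_nhds_zero_iff.1 (tendsto_fisherForm_sub hκ hκn hθn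
      (fun _ => le_max_left |s| ‖u‖) fun _ => le_max_right |s| ‖u‖)
  refine tendsto_integral_exp_mul_I_pow (C := |s| * (1 + |meanA k κ|) + |κ| * ‖u‖ + 1)
    (μ := fun n => fvml k (κn n) (θn n))
    (g := fun n => score (κn n) (θn n) s u)
    (fun n => Continuous.aemeasurable (by unfold score; fun_prop)) ?_
    (fun n => integral_score (hθn1 n) _ _ _) (hV.congr' ?_) hM ha hMa
  · filter_upwards [hB.eventually_le_const (lt_add_one _)] with n hn x
    exact (abs_score_le (hθn1 n) _ _ _ x).trans hn
  · filter_upwards [hκn.eventually_ne hκ] with n hn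
    exact (integral_score_sq (hθn1 n) hn s u).symm

lemma charFun_map_central (N : Fin m → ℕ) (hv : v ∈ paramSet m k) (t : Vec m k) :
    charFun ((sampleLaw N v).map (central v)) t
      = ∏ i, (∫ x, Complex.exp (((N i : ℝ) ^ (-1 / 2 : ℝ) *
          score (conc v i) (loc v i) (conc t i) (loc t i) x : ℝ) * Complex.I)
          ∂fvml k (conc v i) (loc v i)) ^ N i := by
  rw [charFun_apply, integral_map (continuous_central hv).aemeasurable (by fun_prop),
    ← integral_prod_sampleLaw]
  refine integral_congr_ae (.of_forall fun x => ?_)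
  have hinner : ⟪central v x, t⟫ = t ⬝ᵥ central v x := by simp [PiLp.inner_apply, dotProduct]
  simp only [hinner, dotProduct_central hv, ← Complex.exp_sum, ← Finset.sum_mul,
    ← Complex.ofReal_sum, Finset.mul_sum]

lemma tendstoInDistribution_central (hN : ∀ i, Tendsto (fun n => N n i) atTop atTop)
    (hv : v ∈ paramSet m k) (hvn : ∀ n, vn n ∈ paramSet m k) (hlim : Tendsto vn atTop (𝓝 v)) :
    TendstoInDistribution (fun n (x : Sample m k (N n)) => central (vn n) x) atTop
      (id : Vec m k → Vec m k) (fun n => sampleLaw (N n) (vn n))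
      (multivariateGaussian 0 (fisher v)) := by
  refine ⟨fun n => (continuous_central (hvn n)).aemeasurable, aemeasurable_id,
    ProbabilityMeasure.tendsto_of_tendsto_charFun fun t => ?_⟩
  have hprod := tendsto_finsetProd Finset.univ fun (i : Fin m) _ =>
    tendsto_integral_exp_score_pow (hv i).1.ne' (((continuous_conc i).tendsto v).comp hlim)
      (((continuous_loc i).tendsto v).comp hlim) (fun n => (hvn n i).2) (hN i)
      (tendsto_rpow_neg_half (hN i)) (eventually_mul_rpow_neg_half_sq (hN i)) (conc t i) (loc t i)
  have hgauss : ∏ i, Complex.exp (-(fisherForm (conc v i) (loc v i) (conc t i) (loc t i) / 2 : ℝ))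
      = charFun (multivariateGaussian 0 (fisher v)) t := by
    rw [charFun_multivariateGaussian (posSemidef_fisher hv), ← Complex.exp_sum,
      dotProduct_fisher hv]
    congr 1
    push_cast
    simp [Finset.sum_div]
  simp only [Function.comp_apply, ← charFun_map_central _ (hvn _), hgauss] at hprod
  simpa only [ProbabilityMeasure.coe_mk, Measure.map_id] using hprod

end CentralSequence

section LocalAsymptoticNormality

variable {m k : ℕ} {N : ℕ → Fin m → ℕ} {v : Vec m k} {vn τ : ℕ → Vec m k} {C : ℝ}

lemma abs_conc_le (v : Vec m k) (i : Fin m) : |conc v i| ≤ ‖v‖ := PiLp.norm_apply_le v _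

lemma norm_loc_le (v : Vec m k) (i : Fin m) : ‖loc v i‖ ≤ ‖v‖ := by
  refine (sq_le_sq₀ (norm_nonneg _) (norm_nonneg _)).1 ?_
  rw [EuclideanSpace.norm_sq_eq, EuclideanSpace.norm_sq_eq, Fintype.sum_sum_type,
    Fintype.sum_prod_type_right]
  exact (Finset.single_le_sum (f := fun i => ∑ a, ‖v (Sum.inr (a, i))‖ ^ 2)
    (fun i _ => by positivity) (Finset.mem_univ i)).trans (le_add_of_nonneg_left (by positivity))

variable [k.AtLeastTwo]

lemma isLittleOP_llr_sub (hN : ∀ i, Tendsto (fun n => N n i) atTop atTop)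
    (hv : v ∈ paramSet m k) (hvn : ∀ n, vn n ∈ paramSet m k) (hlim : Tendsto vn atTop (𝓝 v))
    (hτ : ∀ n, ‖τ n‖ ≤ C) (hτmem : ∀ n, perturb n (N n) (vn n) (τ n) ∈ paramSet m k) :
    IsLittleOP (fun n => sampleLaw (N n) (vn n)) fun n x =>
      llr (sampleLaw (N n) (perturb n (N n) (vn n) (τ n))) (sampleLaw (N n) (vn n)) x
        - (τ n ⬝ᵥ central (vn n) x - 1 / 2 * (τ n ⬝ᵥ fisher v *ᵥ τ n)) := by
  have hsample (i : Fin m) := (isLittleOP_logRatio (hv i).1.ne'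
    (((continuous_conc i).tendsto v).comp hlim) (((continuous_loc i).tendsto v).comp hlim)
    (fun n => (hvn n i).2) (hN i) (tendsto_rpow_neg_half (hN i))
    (eventually_mul_rpow_neg_half_sq (hN i)) (fun n => (abs_conc_le (τ n) i).trans (hτ n))
    (fun n => (norm_loc_le (τ n) i).trans (hτ n)) (by
      filter_upwards [eventually_ne_atTop 0] with n hn
      exact loc_perturb hn (N n) (vn n) (τ n) i ▸ (hτmem n i).2)).comp_measurePreserving
    (fun n => Continuous.aemeasurable (by unfold logRatio score; fun_prop))
    (fun n => measurePreserving_eval (fun i => Measure.pi fun _ : Fin (N n i) =>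
      fvml k (conc (vn n) i) (loc (vn n) i)) i)
  refine (IsLittleOP.sum Finset.univ fun i _ => hsample i).congr ?_
  filter_upwards [eventually_ne_atTop 0] with n hn
  filter_upwards [llr_sampleLaw (N n) (hvn n) (hτmem n)] with x hx
  rw [hx, dotProduct_central (hvn n), dotProduct_fisher hv, Finset.mul_sum,
    ← Finset.sum_sub_distrib, ← Finset.sum_sub_distrib]
  refine Finset.sum_congr rfl fun i _ => ?_
  rw [conc_perturb hn, loc_perturb hn]
  simp only [Function.comp_apply, Function.eval]
  ring

end LocalAsymptoticNormality

end

end FvML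

theorem mainTheorem5_general (m k : ℕ) [k.AtLeastTwo] (N : ℕ → Fin m → ℕ)
    (hN : ∀ i, Tendsto (fun n => N n i) atTop atTop)
    (v : FvML.Vec m k) (hv : v ∈ FvML.paramSet m k)
    (vn : ℕ → FvML.Vec m k) (hvn : ∀ n, vn n ∈ FvML.paramSet m k)
    (hlim : Tendsto vn atTop (𝓝 v))
    (τ : ℕ → FvML.Vec m k) (hτ : ∃ C : ℝ, ∀ n, ‖τ n‖ ≤ C)
    (hτmem : ∀ n, FvML.perturb n (N n) (vn n) (τ n) ∈ FvML.paramSet m k) :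
    FvML.IsLittleOP (fun n => FvML.sampleLaw (N n) (vn n))
      (fun n x =>
        llr (FvML.sampleLaw (N n) (FvML.perturb n (N n) (vn n) (τ n)))
            (FvML.sampleLaw (N n) (vn n)) x
          - (τ n ⬝ᵥ FvML.central (vn n) x
              - 1 / 2 * (τ n ⬝ᵥ FvML.fisher v *ᵥ τ n))) ∧
    (FvML.fisher v).PosSemidef ∧
    TendstoInDistribution
      (fun n (x : FvML.Sample m k (N n)) => FvML.central (vn n) x) atTop
      (id : FvML.Vec m k → FvML.Vec m k)
      (fun n => FvML.sampleLaw (N n) (vn n))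
      (multivariateGaussian 0 (FvML.fisher v)) :=
  ⟨FvML.isLittleOP_llr_sub hN hv hvn hlim hτ.choose_spec hτmem, FvML.posSemidef_fisher hv,
    FvML.tendstoInDistribution_central hN hv hvn hlim⟩

theorem mainTheorem5 (m k : ℕ) (hm : 2 ≤ m) [k.AtLeastTwo]
    -- sample sizes with total `n`, and the proportions' limits
    (N : ℕ → Fin m → ℕ) (hN : ∀ n, ∑ i, N n i = n)
    (r : Fin m → ℝ) (hr : ∀ i, 0 < r i)
    (hNr : ∀ i, Tendsto (fun n : ℕ => (N n i : ℝ) / n) atTop (𝓝 (r i)))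
    -- the parameter and a sequence of parameters that is root-`n` close to it
    (v : FvML.Vec m k) (hv : v ∈ FvML.paramSet m k)
    (vn : ℕ → FvML.Vec m k) (hvn : ∀ n, vn n ∈ FvML.paramSet m k)
    (hvnO : (fun n => vn n - v) =O[atTop] fun n : ℕ => (n : ℝ) ^ (-1 / 2 : ℝ))
    -- a bounded sequence of perturbations that stay in the parameter set
    (τ : ℕ → FvML.Vec m k) (hτ : ∃ C : ℝ, ∀ n, ‖τ n‖ ≤ C)
    (hτmem : ∀ n, FvML.perturb n (N n) (vn n) (τ n) ∈ FvML.paramSet m k) :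
    FvML.IsLittleOP (fun n => FvML.sampleLaw (N n) (vn n))
      (fun n x =>
        llr (FvML.sampleLaw (N n) (FvML.perturb n (N n) (vn n) (τ n)))
            (FvML.sampleLaw (N n) (vn n)) x
          - (τ n ⬝ᵥ FvML.central (vn n) x
              - 1 / 2 * (τ n ⬝ᵥ FvML.fisher v *ᵥ τ n))) ∧
    (FvML.fisher v).PosSemidef ∧
    TendstoInDistribution
      (fun n (x : FvML.Sample m k (N n)) => FvML.central (vn n) x) atTop
      (id : FvML.Vec m k → FvML.Vec m k)
      (fun n => FvML.sampleLaw (N n) (vn n))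
      (multivariateGaussian 0 (FvML.fisher v)) :=
  mainTheorem5_general m k N (fun i => FvML.tendsto_atTop_of_tendsto_div (hr i) (hNr i)) v hv vn hvn
    (FvML.tendsto_of_sub_isBigO_rpow_neg_half hvnO) τ hτ hτmem
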